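/- **Matroid conventions.** Let $[n]=\{1,\dots,n\}$. A matroid $M'$ is a *parallel extension* (respectively *series extension*) of a matroid $M$ if there is an element $e$ of $M'$ lying in a circuit (respectively cocircuit) of $M'$ of cardinality $2$ such that $M'\setminus e=M$ (respectively $M'/e=M$). A *series-parallel matroid* is a matroid obtained from a single loop or a single coloop by a finite, possibly empty, sequence of series and parallel extensions. A *quasi series-parallel matroid* is a matroid all of whose connected components are series-parallel (the empty matroid is included). For a finite group $G$, a *$G$-labeling* of a matroid $M$ on $E$ is a map $\phi\colon E\to G$, where $\phi,\psi$ are considered equivalent if for every connected component $K$ of $M$ there is $g_K\in G$ with $\phi|_K=g_K\cdot\psi|_K$. Let $\mathcal C(n,k)$ and $\mathcal A(n,k)$ be the sets of series-parallel, respectively quasi series-parallel, matroids on $[n]$ of rank $k$, and let $\mathcal A_G(n,k)$ be the set of all $G$-labeled quasi series-parallel matroids on $[n]$ of rank $k$, that is, of pairs consisting of a quasi series-parallel matroid on $[n]$ of rank $k$ and an equivalence class of $G$-labelings of it. Put $$C(x,y)=\sum_{n\ge 1}\sum_{k=0}^n|\mathcal C(n,k)|\frac{x^n}{n!}y^k,\qquad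 A(x,y)=\sum_{n\ge 0}\sum_{k=0}^n|\mathcal A(n,k)|\frac{x^n}{n!}y^k,\qquad A_G(x,y)=\sum_{n\ge 0}\sum_{k=0}^n|\mathcal A_G(n,k)|\frac{x^n}{n!}y^k .$$ **Proposition 3.2.** Let $G$ be a finite group and $q=|G|$. Then, as formal power series in $x$ with coefficients in $\mathbb Q(y)$, $$C(x,y)=x(y+1)+y\int\left(\frac1y\log(1+xy)+\log(1+x)-x\right)^{\langle -1\rangle}dx,\qquad A(x,y)=\exp(C(x,y)),$$ and $$A_G(x,y)=\exp(C(qx,y))^{1/q}=A(qx,y)^{1/q}.$$ Here $\langle -1\rangle$ denotes the compositional inverse in the variable $x$ ($y$ being treated as a constant), $\int\cdot\,dx$ is the formal antiderivative in $x$ without constant term, and for a power series $F$ in $x$ with constant term $1$, $F^{1/q}=\sum_{j\ge0}\binom{1/q}{j}(F-1)^j$. -/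

import Mathlib

namespace GroupLabeledMatroid

universe u v

section Matroids

variable {α : Type u}

/-- `M'` is a parallel extension of `M`: some `e` lies in a circuit of `M'` of cardinality `2`
and deleting `e` from `M'` gives `M`. -/
def IsParallelExtension (M M' : Matroid α) : Prop :=
  ∃ e ∈ M'.E, (∃ C, M'.IsCircuit C ∧ C.encard = 2 ∧ e ∈ C) ∧ M'.delete {e} = M

/-- `M'` is a series extension of `M`: some `e` lies in a cocircuit of `M'` of cardinality `2`
and contracting `e` in `M'` gives `M`. -/
def IsSeriesExtension (M M' : Matroid α) : Prop :=
  ∃ e ∈ M'.E, (∃ C, M'.IsCocircuit C ∧ C.encard = 2 ∧ e ∈ C) ∧ M'.contract {e} = M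

/-- A series-parallel matroid: obtained from a single loop or a single coloop by a finite,
possibly empty, sequence of series and parallel extensions. -/
inductive IsSeriesParallel : Matroid α → Prop
  | loop (e : α) : IsSeriesParallel (Matroid.loopyOn {e})
  | coloop (e : α) : IsSeriesParallel (Matroid.freeOn {e})
  | parallel (M M' : Matroid α) :
      IsSeriesParallel M → IsParallelExtension M M' → IsSeriesParallel M'
  | series (M M' : Matroid α) :
      IsSeriesParallel M → IsSeriesExtension M M' → IsSeriesParallel M'

/-- The connected component of `e` in `M`: the set of all elements of the ground set that are
equal to `e` or lie in a common circuit with `e`. -/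
def component (M : Matroid α) (e : α) : Set α :=
  {f | f ∈ M.E ∧ (f = e ∨ ∃ C, M.IsCircuit C ∧ e ∈ C ∧ f ∈ C)}

/-- `K` is (the ground set of) a connected component of `M`. -/
def IsComponent (M : Matroid α) (K : Set α) : Prop :=
  ∃ e ∈ M.E, K = component M e

/-- A quasi series-parallel matroid: every connected component is a series-parallel matroid. -/
def IsQuasiSeriesParallel (M : Matroid α) : Prop :=
  ∀ K, IsComponent M K → IsSeriesParallel (M.restrict K)

/-- Equivalence of `G`-labelings of `M`: on each connected component the two labelings differ
by left multiplication by an element of `G` that may depend on the component. -/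
def labelingSetoid (G : Type v) [Group G] (M : Matroid α) : Setoid (M.E → G) where
  r φ ψ := ∀ K, IsComponent M K → ∃ g : G, ∀ e : M.E, (e : α) ∈ K → φ e = g * ψ e
  iseqv :=
    { refl := fun φ K _ => ⟨1, fun e _ => (one_mul _).symm⟩
      symm := by
        intro φ ψ h K hK
        obtain ⟨g, hg⟩ := h K hK
        exact ⟨g⁻¹, fun e he => by rw [hg e he, inv_mul_cancel_left]⟩
      trans := by
        intro φ ψ χ h h' K hK
        obtain ⟨g, hg⟩ := h K hK
        obtain ⟨g', hg'⟩ := h' K hK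
        exact ⟨g * g', fun e he => by rw [hg e he, hg' e he, mul_assoc]⟩ }

end Matroids

section Counting

/-- Series-parallel matroids of rank `k` on the ground set `[n]`. -/
def SPMatroid (n k : ℕ) : Type :=
  {M : Matroid (Fin n) // M.E = Set.univ ∧ IsSeriesParallel M ∧ M.eRank = (k : ℕ∞)}

/-- Quasi series-parallel matroids of rank `k` on the ground set `[n]`. -/
def QSPMatroid (n k : ℕ) : Type :=
  {M : Matroid (Fin n) // M.E = Set.univ ∧ IsQuasiSeriesParallel M ∧ M.eRank = (k : ℕ∞)}

/-- `G`-labeled quasi series-parallel matroids of rank `k` on `[n]`: a quasi series-parallel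
matroid together with an equivalence class of `G`-labelings of it. -/
def LabeledQSPMatroid (G : Type v) [Group G] (n k : ℕ) : Type v :=
  Σ M : QSPMatroid n k, Quotient (labelingSetoid G M.1)

end Counting

section Series

open PowerSeries

/-- The bivariate generating functions are power series in `x` with coefficients
in the field `ℚ(y)`. -/
abbrev Coeffs : Type := RatFunc ℚ

/-- The variable `y`, as an element of `ℚ(y)`. -/
noncomputable def y : Coeffs := RatFunc.X

/-- The series `∑_{n ≥ 0} ∑_{k=0}^{n} a(n,k) (x^n / n!) y^k`. -/
noncomputable def egf (a : ℕ → ℕ → ℕ) : PowerSeries Coeffs :=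
  PowerSeries.mk fun n =>
    ∑ k ∈ Finset.range (n + 1), ((a n k : Coeffs) / (n.factorial : Coeffs)) * y ^ k

/-- The generating function of series-parallel matroids. The term `n = 0` vanishes, since a
series-parallel matroid has a nonempty ground set. -/
noncomputable def genC : PowerSeries Coeffs := egf fun n k => Nat.card (SPMatroid n k)

/-- The generating function of quasi series-parallel matroids. -/
noncomputable def genA : PowerSeries Coeffs := egf fun n k => Nat.card (QSPMatroid n k)

/-- The generating function of `G`-labeled quasi series-parallel matroids. -/
noncomputable def genAG (G : Type v) [Group G] : PowerSeries Coeffs :=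
  egf fun n k => Nat.card (LabeledQSPMatroid G n k)

/-- `f(x) ↦ f(c x)`. -/
noncomputable def scale (c : Coeffs) (f : PowerSeries Coeffs) : PowerSeries Coeffs :=
  PowerSeries.rescale c f

/-- The formal antiderivative in `x` with constant term zero. -/
noncomputable def antideriv (f : PowerSeries Coeffs) : PowerSeries Coeffs :=
  PowerSeries.mk fun n => if n = 0 then 0 else PowerSeries.coeff (n - 1) f / (n : Coeffs)

/-- `exp(f)`, for a series `f` without constant term. -/
noncomputable def expOf (f : PowerSeries Coeffs) : PowerSeries Coeffs :=
  (PowerSeries.exp Coeffs).subst f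

/-- `f^r = ∑_{j ≥ 0} (r choose j) (f - 1)^j`, for a series `f` with constant term `1` and
a rational exponent `r`. -/
noncomputable def ratPow (f : PowerSeries Coeffs) (r : ℚ) : PowerSeries Coeffs :=
  (PowerSeries.binomialSeries Coeffs r).subst (f - 1)

/-- The series `(1/y) log(1 + x y) + log(1 + x) - x`. -/
noncomputable def innerSeries : PowerSeries Coeffs :=
  PowerSeries.C y⁻¹ * scale y (PowerSeries.log Coeffs) + PowerSeries.log Coeffs - PowerSeries.X

theorem coeff_one_innerSeries : PowerSeries.coeff 1 innerSeries = 1 := by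
  have hy : y ≠ 0 := RatFunc.X_ne_zero
  simp [innerSeries, scale, PowerSeries.coeff_rescale, hy]

theorem isUnit_coeff_one_innerSeries : IsUnit (PowerSeries.coeff 1 innerSeries) := by
  rw [coeff_one_innerSeries]; exact isUnit_one

theorem constantCoeff_innerSeries : PowerSeries.constantCoeff innerSeries = 0 := by
  have h : PowerSeries.constantCoeff (scale y (PowerSeries.log Coeffs)) = 0 := by
    rw [scale, ← PowerSeries.coeff_zero_eq_constantCoeff_apply, PowerSeries.coeff_rescale]
    simp
  simp [innerSeries, h]

/-- The compositional inverse, in the variable `x`, of `innerSeries`. -/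
noncomputable def innerInverse : PowerSeries Coeffs :=
  PowerSeries.substInvOfIsUnit innerSeries isUnit_coeff_one_innerSeries

/-- The explicit series
`C(x,y) = x (y + 1) + y ∫ ((1/y) log(1 + x y) + log(1 + x) - x)^{⟨-1⟩} dx`. -/
noncomputable def explicitC : PowerSeries Coeffs :=
  PowerSeries.X * PowerSeries.C (y + 1) + PowerSeries.C y * antideriv innerInverse

end Series

end GroupLabeledMatroid

namespace GroupLabeledMatroid

open Set Matroid

universe u v w

section MatroidCounts

variable {α : Type u} {β : Type v}

section Transport

theorem map_delete (M : Matroid α) (f : α → β) (hf : InjOn f M.E) {D : Set α} (hD : D ⊆ M.E) :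
    (M.map f hf).delete (f '' D) = (M.delete D).map f (hf.mono sdiff_subset) := by
  refine ext_indep ?_ fun I hI => ?_
  · simp [hf.image_sdiff_subset hD]
  · simp only [delete_indep_iff, map_indep_iff]
    constructor
    · rintro ⟨⟨J, hJ, rfl⟩, hdj⟩
      exact ⟨J, ⟨hJ, hdj.of_image⟩, rfl⟩
    · rintro ⟨J, ⟨hJ, hdj⟩, rfl⟩
      refine ⟨⟨J, hJ, rfl⟩, disjoint_image_image fun a ha b hb hab => ?_⟩
      exact hdj.ne_of_mem ha hb (hf (hJ.subset_ground ha) (hD hb) hab)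

theorem map_contract (M : Matroid α) (f : α → β) (hf : InjOn f M.E) {D : Set α} (hD : D ⊆ M.E) :
    (M.map f hf).contract (f '' D) = (M.contract D).map f (hf.mono sdiff_subset) := by
  rw [← dual_inj, dual_contract, map_dual, map_delete M✶ f hf hD, map_dual]
  simp only [dual_contract]

theorem map_isCircuit {M : Matroid α} {f : α → β} (hf : InjOn f M.E) {C : Set α}
    (hC : M.IsCircuit C) : (M.map f hf).IsCircuit (f '' C) := by
  rw [isCircuit_iff_dep_forall_sdiff_singleton_indep]
  refine ⟨map_dep_iff.2 ⟨C, hC.dep, rfl⟩, ?_⟩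
  rintro _ ⟨e, he, rfl⟩
  rw [← image_singleton,
    ← (hf.mono hC.subset_ground).image_sdiff_subset (singleton_subset_iff.2 he)]
  exact (hC.sdiff_singleton_indep he).map f hf

theorem map_map_of_leftInvOn (M : Matroid α) {f : α → β} {g : β → α} (hf : InjOn f M.E)
    (hg : LeftInvOn g f M.E) (hgi : InjOn g (M.map f hf).E) : (M.map f hf).map g hgi = M := by
  refine ext_indep ?_ fun I hI => ?_
  · simp [hg.image_image]
  · simp only [map_indep_iff]
    constructor
    · rintro ⟨_, ⟨J, hJ, rfl⟩, rfl⟩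
      rwa [(hg.mono hJ.subset_ground).image_image]
    · intro hI
      exact ⟨_, ⟨I, hI, rfl⟩, ((hg.mono hI.subset_ground).image_image).symm⟩

end Transport

section Connectivity

/-- `e` and `f` are equal or lie in a common circuit. -/
def Linked (M : Matroid α) (e f : α) : Prop := f = e ∨ ∃ C, M.IsCircuit C ∧ e ∈ C ∧ f ∈ C

/-- A connected (possibly empty) matroid: any two elements are linked. -/
def Conn (M : Matroid α) : Prop := ∀ e ∈ M.E, ∀ f ∈ M.E, Linked M e f

theorem Linked.refl (M : Matroid α) (e : α) : Linked M e e := Or.inl rfl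

theorem Linked.symm {M : Matroid α} {e f : α} (h : Linked M e f) : Linked M f e := by
  rcases h with rfl | ⟨C, hC, he, hf⟩
  · exact Or.inl rfl
  · exact Or.inr ⟨C, hC, hf, he⟩

theorem exists_isCircuit_of_inter_nonempty [Finite α] {M : Matroid α} {e g : α} (n : ℕ) :
    ∀ C₁ C₂ : Set α, (C₁ ∪ C₂).ncard = n → M.IsCircuit C₁ → M.IsCircuit C₂ → e ∈ C₁ → g ∈ C₂ →
      (C₁ ∩ C₂).Nonempty → ∃ C, M.IsCircuit C ∧ e ∈ C ∧ g ∈ C := by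
  induction n using Nat.strong_induction_on with
  | _ n ih =>
  intro C₁ C₂ hn hC₁ hC₂ he hg hne
  by_contra hno
  have heC : ∀ C, M.IsCircuit C → e ∈ C → g ∉ C := fun C hC h h' => hno ⟨C, hC, h, h'⟩
  obtain ⟨f, hf₁, hf₂⟩ := hne
  have he₂ : e ∉ C₂ := fun h => heC C₂ hC₂ h hg
  have hg₁ : g ∉ C₁ := heC C₁ hC₁ he
  obtain ⟨C₃, hC₃s, hC₃, he₃⟩ := hC₁.strong_elimination hC₂ hf₁ hf₂ he he₂
  obtain ⟨C₄, hC₄s, hC₄, hg₄⟩ := hC₂.strong_elimination hC₁ hf₂ hf₁ hg hg₁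
  have hsub : ∀ C D : Set α, M.IsCircuit C → M.IsCircuit D → C ⊆ (C₁ ∪ C₂) → C ⊆ D → f ∉ C →
      f ∈ D → False := by
    intro C D hC hD _ hCD hfC hfD
    exact hfC (hC.eq_of_subset_isCircuit hD hCD ▸ hfD)
  have h32 : (C₃ ∩ C₂).Nonempty := by
    by_contra h
    refine hsub C₃ C₁ hC₃ hC₁ (hC₃s.trans sdiff_subset) (fun x hx => ?_)
      (fun h => (hC₃s h).2 rfl) hf₁
    exact (hC₃s hx).1.resolve_right fun hx2 => h ⟨x, hx, hx2⟩
  have h41 : (C₄ ∩ (C₁ \ C₂)).Nonempty := by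
    by_contra h
    refine hsub C₄ C₂ hC₄ hC₂ ((hC₄s.trans sdiff_subset).trans (union_comm _ _).subset)
      (fun x hx => ?_) (fun h => (hC₄s h).2 rfl) hf₂
    by_contra hx2
    exact h ⟨x, hx, (hC₄s hx).1.resolve_left hx2, hx2⟩
  have hlt : ∀ D : Set α, D ⊆ C₁ ∪ C₂ → ∀ x ∈ C₁ ∪ C₂, x ∉ D → D.ncard < n := by
    intro D hD x hx hxD
    rw [← hn]
    exact ncard_lt_ncard ⟨hD, fun h => hxD (h hx)⟩ (toFinite _)
  have h13 : C₁ \ C₂ ⊆ C₃ := by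
    intro x hx
    by_contra hx3
    refine hno (ih _ (hlt (C₃ ∪ C₂) (union_subset (hC₃s.trans sdiff_subset) subset_union_right) x
      (Or.inl hx.1) ?_) C₃ C₂ rfl hC₃ hC₂ he₃ hg h32)
    rintro (h | h)
    exacts [hx3 h, hx.2 h]
  refine hno (ih _ (hlt (C₃ ∪ C₄) (union_subset (hC₃s.trans sdiff_subset)
    ((hC₄s.trans sdiff_subset).trans (union_comm _ _).subset)) f (Or.inl hf₁) ?_) C₃ C₄ rfl
    hC₃ hC₄ he₃ hg₄ ?_)
  · rintro (h | h)
    exacts [(hC₃s h).2 rfl, (hC₄s h).2 rfl]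
  · obtain ⟨x, hx, hx'⟩ := h41
    exact ⟨x, h13 hx', hx⟩

theorem Linked.trans [Finite α] {M : Matroid α} {e f g : α} (h : Linked M e f)
    (h' : Linked M f g) : Linked M e g := by
  rcases h with rfl | ⟨C, hC, he, hf⟩
  · exact h'
  rcases h' with rfl | ⟨D, hD, hf', hg⟩
  · exact Or.inr ⟨C, hC, he, hf⟩
  · exact Or.inr (exists_isCircuit_of_inter_nonempty _ C D rfl hC hD he hg ⟨f, hf, hf'⟩)

theorem conn_of_forall_linked [Finite α] {M : Matroid α} {x : α}
    (h : ∀ g ∈ M.E, Linked M x g) : Conn M :=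
  fun e he f hf => (h e he).symm.trans (h f hf)

theorem Linked.of_restrict {M : Matroid α} {R : Set α} (hR : R ⊆ M.E) {e f : α}
    (h : Linked (M.restrict R) e f) : Linked M e f := by
  rcases h with rfl | ⟨C, hC, he, hf⟩
  · exact Or.inl rfl
  · exact Or.inr ⟨C, ((restrict_isCircuit_iff hR).1 hC).1, he, hf⟩

theorem Conn.isNonloop {M : Matroid α} (h : Conn M) {x y : α} (hx : x ∈ M.E) (hy : y ∈ M.E)
    (hxy : x ≠ y) : M.IsNonloop x := by
  rcases h x hx y hy with rfl | ⟨C, hC, hxC, hyC⟩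
  · exact absurd rfl hxy
  · exact hC.isNonloop_of_mem ⟨x, hxC, y, hyC, hxy⟩ hxC

end Connectivity

section ParallelPairs

/-- `e` and `f` are distinct and form a circuit. -/
def Par (M : Matroid α) (e f : α) : Prop := e ≠ f ∧ M.IsCircuit {e, f}

/-- `e` and `f` are distinct and form a cocircuit. -/
def Ser (M : Matroid α) (e f : α) : Prop := e ≠ f ∧ M.IsCocircuit {e, f}

variable {M : Matroid α} {e f g : α}

theorem par_dual : Par M✶ e f ↔ Ser M e f := Iff.rfl

theorem ser_dual : Ser M✶ e f ↔ Par M e f := by simp [Par, Ser]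

theorem Par.symm (h : Par M e f) : Par M f e := ⟨h.1.symm, by rw [pair_comm]; exact h.2⟩

theorem Ser.symm (h : Ser M e f) : Ser M f e := ⟨h.1.symm, by rw [pair_comm]; exact h.2⟩

theorem Par.left_mem (h : Par M e f) : e ∈ M.E := h.2.subset_ground (by simp)

theorem Par.right_mem (h : Par M e f) : f ∈ M.E := h.2.subset_ground (by simp)

theorem Ser.left_mem (h : Ser M e f) : e ∈ M.E := h.2.subset_ground (by simp)

theorem Ser.right_mem (h : Ser M e f) : f ∈ M.E := h.2.subset_ground (by simp)

theorem Par.isNonloop (h : Par M e f) : M.IsNonloop e :=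
  h.2.isNonloop_of_mem ⟨e, by simp, f, by simp, h.1⟩ (by simp)

theorem Par.closure_eq (h : Par M e f) : M.closure {e} = M.closure {f} :=
  (h.isNonloop.closure_eq_closure_iff_isCircuit_of_ne h.1).2 h.2

theorem par_of_closure_eq (he : M.IsNonloop e) (hef : e ≠ f)
    (h : M.closure {e} = M.closure {f}) : Par M e f :=
  ⟨hef, (he.closure_eq_closure_iff_isCircuit_of_ne hef).1 h⟩

theorem Par.trans (h : Par M e f) (h' : Par M f g) (heg : e ≠ g) : Par M e g :=
  par_of_closure_eq h.isNonloop heg (h.closure_eq.trans h'.closure_eq)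

theorem Par.linked (h : Par M e f) : Linked M e f := Or.inr ⟨_, h.2, by simp, by simp⟩

theorem isParallelExtension_iff {M M' : Matroid α} :
    IsParallelExtension M M' ↔ ∃ e f, Par M' e f ∧ M'.delete {e} = M := by
  constructor
  · rintro ⟨e, he, ⟨C, hC, hC2, heC⟩, h⟩
    obtain ⟨x, y, hxy, rfl⟩ := encard_eq_two.1 hC2
    rcases heC with rfl | rfl
    · exact ⟨e, y, ⟨hxy, hC⟩, h⟩
    · exact ⟨e, x, Par.symm ⟨hxy, hC⟩, h⟩
  · rintro ⟨e, f, h, h'⟩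
    exact ⟨e, h.left_mem, ⟨_, h.2, encard_pair h.1, by simp⟩, h'⟩

theorem isSeriesExtension_iff {M M' : Matroid α} :
    IsSeriesExtension M M' ↔ ∃ e f, Ser M' e f ∧ M'.contract {e} = M := by
  constructor
  · rintro ⟨e, he, ⟨C, hC, hC2, heC⟩, h⟩
    obtain ⟨x, y, hxy, rfl⟩ := encard_eq_two.1 hC2
    rcases heC with rfl | rfl
    · exact ⟨e, y, ⟨hxy, hC⟩, h⟩
    · exact ⟨e, x, Ser.symm ⟨hxy, hC⟩, h⟩
  · rintro ⟨e, f, h, h'⟩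
    exact ⟨e, h.left_mem, ⟨_, h.2, encard_pair h.1, by simp⟩, h'⟩

theorem Par.insert_indep (h : Par M e f) {J : Set α} (heJ : e ∉ J) (hJ : M.Indep (insert e J)) :
    M.Indep (insert f J) := by
  by_cases hf : f ∈ J
  · exact absurd (hJ.subset (by simp [insert_subset_iff, hf])) h.2.not_indep
  have hJ' : M.Indep J := hJ.subset (subset_insert _ _)
  rw [hJ'.insert_indep_iff_of_notMem hf]
  refine ⟨h.right_mem, fun hcl => ?_⟩
  have hecl : e ∈ M.closure J := by
    have h1 : M.closure {f} ⊆ M.closure J :=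
      M.closure_subset_closure_of_subset_closure (singleton_subset_iff.2 hcl)
    exact h1 (h.closure_eq ▸ M.mem_closure_self e h.left_mem)
  exact ((hJ'.insert_indep_iff_of_notMem heJ).1 hJ).2 hecl

open Classical in
theorem Par.image_swap_indep (h : Par M e f) {J : Set α} (hJ : M.Indep J) :
    M.Indep (Equiv.swap e f '' J) := by
  have key : ∀ {e f : α}, Par M e f → e ∈ J → M.Indep (Equiv.swap e f '' J) := by
    intro e f h he
    have hf : f ∉ J := fun hf =>
      h.2.not_indep (hJ.subset (insert_subset he (singleton_subset_iff.2 hf)))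
    have : Equiv.swap e f '' J = insert f (J \ {e}) := by
      ext x
      rw [Equiv.image_eq_preimage_symm, mem_preimage, Equiv.symm_swap, Equiv.swap_apply_def]
      split_ifs with h1 h2
      · subst h1; simp [hf, h.1]
      · subst h2; simp [he]
      · simp [h1, h2]
    rw [this]
    exact h.insert_indep (by simp) (by simpa [insert_eq_of_mem he] using hJ)
  by_cases he : e ∈ J
  · exact key h he
  by_cases hf : f ∈ J
  · rw [Equiv.swap_comm]; exact key h.symm hf
  convert hJ using 1
  ext x
  rw [Equiv.image_eq_preimage_symm, mem_preimage, Equiv.symm_swap, Equiv.swap_apply_def]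
  split_ifs with h1 h2
  · subst h1; simp [he, hf]
  · subst h2; simp [he, hf]
  · rfl

open Classical in
theorem Par.image_swap_ground (h : Par M e f) : Equiv.swap e f '' M.E = M.E := by
  ext x
  rw [Equiv.image_eq_preimage_symm, mem_preimage, Equiv.symm_swap, Equiv.swap_apply_def]
  split_ifs with h1 h2
  · subst h1; simp [h.left_mem, h.right_mem]
  · subst h2; simp [h.left_mem, h.right_mem]
  · rfl

open Classical in
theorem Par.map_swap (h : Par M e f) : M.map (Equiv.swap e f) (Equiv.injective _).injOn = M := by
  refine ext_indep (by simpa using h.image_swap_ground) fun I hI => ?_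
  rw [map_indep_iff]
  constructor
  · rintro ⟨J, hJ, rfl⟩
    exact h.image_swap_indep hJ
  · intro hI
    exact ⟨_, h.image_swap_indep hI, by simp [← image_comp]⟩

open Classical in
theorem Par.image_swap_isCircuit (h : Par M e f) {C : Set α} (hC : M.IsCircuit C) :
    M.IsCircuit (Equiv.swap e f '' C) := by
  have := map_isCircuit (f := Equiv.swap e f) (Equiv.injective _).injOn hC
  rwa [h.map_swap] at this

open Classical in
theorem Par.delete_right (h : Par M e f) :
    M.delete {f} = (M.delete {e}).map (Equiv.swap e f) (Equiv.injective _).injOn := by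
  rw [← map_delete M (Equiv.swap e f) (Equiv.injective _).injOn
    (singleton_subset_iff.2 h.left_mem), h.map_swap]
  simp

theorem Par.delete (h : Par M e f) (hg : g ≠ e) (hg' : g ≠ f) : Par (M.delete {g}) e f :=
  ⟨h.1, delete_isCircuit_iff.2 ⟨h.2, by simp [hg, hg']⟩⟩

theorem Par.of_delete {D : Set α} (h : Par (M.delete D) e f) : Par M e f :=
  ⟨h.1, h.2.of_delete⟩

theorem Par.contract_isLoop_iff (h : Par M e f) (hg : g ≠ e) (hg' : g ≠ f) :
    (M.contract {g}).IsLoop e ↔ (M.contract {g}).IsLoop f := by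
  simp only [Matroid.contract_isLoop_iff_mem_closure, mem_singleton_iff, hg.symm, hg'.symm,
    not_false_eq_true, and_true]
  rw [← singleton_subset_iff, ← M.closure_subset_closure_iff_subset_closure
    (singleton_subset_iff.2 h.left_mem), h.closure_eq, M.closure_subset_closure_iff_subset_closure
    (singleton_subset_iff.2 h.right_mem), singleton_subset_iff]

theorem Par.contract (h : Par M e f) (hg : g ≠ e) (hg' : g ≠ f)
    (hl : ¬ (M.contract {g}).IsLoop e) : Par (M.contract {g}) e f := by
  have hl' := mt (h.contract_isLoop_iff hg hg').2 hl
  refine ⟨h.1, ?_⟩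
  have heE : e ∈ (M.contract {g}).E := ⟨h.left_mem, hg.symm⟩
  have hfE : f ∈ (M.contract {g}).E := ⟨h.right_mem, hg'.symm⟩
  have hdep : (M.contract {g}).Dep {e, f} := h.2.contract_dep (by simp [hg, hg'])
  rw [isCircuit_iff_dep_forall_sdiff_singleton_indep]
  refine ⟨hdep, ?_⟩
  rintro x (rfl | rfl)
  · rw [pair_sdiff_left h.1, indep_singleton]
    exact isNonloop_of_not_isLoop hfE hl'
  · rw [pair_sdiff_right h.1, indep_singleton]
    exact isNonloop_of_not_isLoop heE hl

theorem Par.contract_isLoop (h : Par M e f) : (M.contract {e}).IsLoop f := by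
  rw [contract_isLoop_iff_mem_closure, h.closure_eq]
  exact ⟨M.mem_closure_self f h.right_mem, h.1.symm⟩

theorem Par.contract_delete (h : Par M e f) :
    (M.contract {e}).delete {f} = (M.contract {f}).delete {e} := by
  have h1 : M.IsBasis {e} {e, f} := by
    have := h.2.sdiff_singleton_isBasis (e := f) (by simp)
    rwa [pair_sdiff_right h.1] at this
  have h2 : M.IsBasis {f} {e, f} := by
    have := h.2.sdiff_singleton_isBasis (e := e) (by simp)
    rwa [pair_sdiff_left h.1] at this
  have h3 := h1.contract_eq_contract_delete
  rw [h2.contract_eq_contract_delete, pair_sdiff_left h.1, pair_sdiff_right h.1] at h3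
  exact h3.symm

open Classical in
theorem Par.conn_delete_iff [Finite α] (h : Par M e f) : Conn (M.delete {e}) ↔ Conn M := by
  constructor
  · intro hc
    refine conn_of_forall_linked (x := f) fun g hg => ?_
    by_cases hge : g = e
    · subst hge; exact h.symm.linked
    · exact (hc f ⟨h.right_mem, h.1.symm⟩ g ⟨hg, hge⟩).of_restrict sdiff_subset
  · intro hc g hg k hk
    rcases hc g hg.1 k hk.1 with rfl | ⟨C, hC, hgC, hkC⟩
    · exact Linked.refl _ _
    by_cases he : e ∈ C
    · by_cases hf : f ∈ C
      · have hCe : {e, f} = C :=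
          h.2.eq_of_subset_isCircuit hC (insert_subset he (singleton_subset_iff.2 hf))
        subst hCe
        have h1 : g = f := hgC.resolve_left hg.2
        have h2 : k = f := hkC.resolve_left hk.2
        rw [h1, h2]
        exact Linked.refl _ _
      · have hsw : ∀ x, x ∈ C → x ≠ e → x ∈ Equiv.swap e f '' C := fun x hx hxe =>
          ⟨x, hx, Equiv.swap_apply_of_ne_of_ne hxe (fun hxf => hf (hxf ▸ hx))⟩
        refine Or.inr ⟨_, delete_isCircuit_iff.2 ⟨h.image_swap_isCircuit hC, ?_⟩,
          hsw g hgC hg.2, hsw k hkC hk.2⟩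
        rw [disjoint_singleton_right]
        rintro ⟨x, hx, hxe⟩
        rw [Equiv.swap_apply_eq_iff, Equiv.swap_apply_left] at hxe
        exact hf (hxe ▸ hx)
    · exact Or.inr ⟨C, delete_isCircuit_iff.2 ⟨hC, by simpa using he⟩, hgC, hkC⟩

theorem Ser.mem_of_mem (h : Ser M e f) {C : Set α} (hC : M.IsCircuit C) (he : e ∈ C) : f ∈ C := by
  by_contra hf
  refine hC.inter_isCocircuit_ne_singleton h.2 (e := e) ?_
  ext x
  simp only [mem_inter_iff, mem_insert_iff, mem_singleton_iff]
  constructor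
  · rintro ⟨hx, rfl | rfl⟩
    · rfl
    · exact absurd hx hf
  · rintro rfl; exact ⟨he, Or.inl rfl⟩

theorem Ser.exists_isCircuit (h : Ser M e f) : ∃ C, M.IsCircuit C ∧ e ∈ C := by
  have hnl : M✶.IsNonloop e := Par.isNonloop h
  obtain ⟨C, hC, heC⟩ := exists_mem_isCircuit_of_not_isColoop (M := M) h.left_mem
    (fun hco => hnl.not_isLoop hco)
  exact ⟨C, hC, heC⟩

theorem Ser.conn_contract_iff [Finite α] (h : Ser M e f) : Conn (M.contract {e}) ↔ Conn M := by
  constructor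
  · intro hc
    refine conn_of_forall_linked (x := f) fun g hg => ?_
    by_cases hge : g = e
    · subst hge
      obtain ⟨C, hC, heC⟩ := h.exists_isCircuit
      exact Or.inr ⟨C, hC, h.mem_of_mem hC heC, heC⟩
    · rcases hc f ⟨h.right_mem, h.1.symm⟩ g ⟨hg, hge⟩ with hfg | ⟨C, hC, hfC, hgC⟩
      · exact Or.inl hfg
      · obtain ⟨C', hC', hCC', -⟩ := hC.exists_subset_isCircuit_of_contract
        exact Or.inr ⟨C', hC', hCC' hfC, hCC' hgC⟩
  · intro hc g hg k hk
    rcases hc g hg.1 k hk.1 with rfl | ⟨C, hC, hgC, hkC⟩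
    · exact Linked.refl _ _
    by_cases he : e ∈ C
    · exact Or.inr ⟨C \ {e}, hC.contractElem_isCircuit ⟨g, hgC, e, he, hg.2⟩ he, ⟨hgC, hg.2⟩,
        ⟨hkC, hk.2⟩⟩
    · obtain ⟨D, hDC, hD⟩ := (hC.contract_dep (C := {e}) (by simpa using he)).exists_isCircuit_subset
      obtain ⟨D', hD', hDD', hD'e⟩ := hD.exists_subset_isCircuit_of_contract
      have heD' : e ∉ D' := by
        intro heD'
        have hf := h.mem_of_mem hD' heD'
        have hfC : f ∈ C := hDC ((hD'e hf).resolve_right h.1.symm)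
        exact he (h.symm.mem_of_mem hC hfC)
      have hD'D : D' ⊆ D := fun x hx => (hD'e hx).resolve_right fun hxe => heD' (hxe ▸ hx)
      have : D = C := (hDD'.antisymm hD'D).trans
        (hD'.eq_of_subset_isCircuit hC (hD'D.trans hDC))
      exact Or.inr ⟨C, this ▸ hD, hgC, hkC⟩

end ParallelPairs

section Reducible

/-- The matroids obtained from the empty matroid by adding loops, coloops, elements in parallel
and elements in series. -/
inductive IsReducible : Matroid α → Prop
  | empty (M : Matroid α) : M.E = ∅ → IsReducible M
  | loop (M : Matroid α) (e : α) : M.IsLoop e → IsReducible (M.delete {e}) → IsReducible M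
  | coloop (M : Matroid α) (e : α) : M.IsColoop e → IsReducible (M.contract {e}) → IsReducible M
  | par (M : Matroid α) (e f : α) : Par M e f → IsReducible (M.delete {e}) → IsReducible M
  | ser (M : Matroid α) (e f : α) : Ser M e f → IsReducible (M.contract {e}) → IsReducible M

theorem IsReducible.dual {M : Matroid α} (h : IsReducible M) : IsReducible M✶ := by
  induction h with
  | empty M h => exact .empty _ h
  | loop M e he _ ih => exact .coloop _ e he.dual_isColoop (by rwa [← dual_delete])
  | coloop M e he _ ih => exact .loop _ e he.dual_isLoop (by rwa [← dual_contract])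
  | par M e f he _ ih => exact .ser _ e f (ser_dual.2 he) (by rwa [← dual_delete])
  | ser M e f he _ ih => exact .par _ e f (par_dual.2 he) (by rwa [← dual_contract])

theorem Par.map {M : Matroid α} {e f : α} (h : Par M e f) {σ : α → β} (hσ : InjOn σ M.E) :
    Par (M.map σ hσ) (σ e) (σ f) :=
  ⟨fun hef => h.1 (hσ h.left_mem h.right_mem hef), by
    rw [← image_pair]; exact map_isCircuit hσ h.2⟩

theorem Ser.map {M : Matroid α} {e f : α} (h : Ser M e f) {σ : α → β} (hσ : InjOn σ M.E) :
    Ser (M.map σ hσ) (σ e) (σ f) := by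
  rw [← par_dual, map_dual]
  exact Par.map (M := M✶) h hσ

theorem map_delete_singleton {M : Matroid α} {e : α} (he : e ∈ M.E) {σ : α → β}
    (hσ : InjOn σ M.E) :
    (M.map σ hσ).delete {σ e} = (M.delete {e}).map σ (hσ.mono sdiff_subset) := by
  rw [← map_delete M σ hσ (singleton_subset_iff.2 he), image_singleton]

theorem map_contract_singleton {M : Matroid α} {e : α} (he : e ∈ M.E) {σ : α → β}
    (hσ : InjOn σ M.E) :
    (M.map σ hσ).contract {σ e} = (M.contract {e}).map σ (hσ.mono sdiff_subset) := by
  rw [← map_contract M σ hσ (singleton_subset_iff.2 he), image_singleton]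

theorem IsReducible.map {M : Matroid α} (h : IsReducible M) {σ : α → β} (hσ : InjOn σ M.E) :
    IsReducible (M.map σ hσ) := by
  induction h with
  | empty M h => exact .empty _ (by simp [h])
  | loop M e he _ ih =>
    exact .loop _ (σ e) ((map_isLoop_iff he.mem_ground).2 he)
      (by rw [map_delete_singleton he.mem_ground]; exact ih _)
  | coloop M e he _ ih =>
    refine .coloop _ (σ e) ?_ (by rw [map_contract_singleton he.mem_ground]; exact ih _)
    rw [← dual_isLoop_iff_isColoop, map_dual]
    exact (map_isLoop_iff (M := M✶) he.mem_ground).2 he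
  | par M e f he _ ih =>
    exact .par _ (σ e) (σ f) (he.map hσ) (by rw [map_delete_singleton he.left_mem]; exact ih _)
  | ser M e f he _ ih =>
    exact .ser _ (σ e) (σ f) (he.map hσ) (by rw [map_contract_singleton he.left_mem]; exact ih _)

theorem IsLoop.isLoop_contract {M : Matroid α} {e x : α} (he : M.IsLoop e) (hx : x ≠ e) :
    (M.contract {x}).IsLoop e :=
  (contract_isLoop_iff_mem_closure).2 ⟨he.mem_closure _, hx.symm⟩

theorem isReducible_minors_of_loop {M : Matroid α} {e : α} (he : M.IsLoop e)
    (hr : IsReducible (M.delete {e}))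
    (ih : ∀ x, IsReducible ((M.delete {e}).delete {x}) ∧ IsReducible ((M.delete {e}).contract {x}))
    (x : α) : IsReducible (M.delete {x}) ∧ IsReducible (M.contract {x}) := by
  by_cases hx : x = e
  · subst hx
    exact ⟨hr, by rwa [contract_eq_delete_of_subset_loops (singleton_subset_iff.2 he)]⟩
  refine ⟨.loop _ e (delete_isLoop_iff.2 ⟨he, Ne.symm hx⟩) ?_,
    .loop _ e (IsLoop.isLoop_contract he hx) ?_⟩
  · rw [delete_comm]; exact (ih x).1
  · rw [contract_delete_comm _ (by simpa using hx)]; exact (ih x).2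

open Classical in
theorem isReducible_minors_of_par {M : Matroid α} {e f : α} (he : Par M e f)
    (hr : IsReducible (M.delete {e}))
    (ih : ∀ x, IsReducible ((M.delete {e}).delete {x}) ∧ IsReducible ((M.delete {e}).contract {x}))
    (x : α) : IsReducible (M.delete {x}) ∧ IsReducible (M.contract {x}) := by
  have hfe : IsReducible ((M.contract {f}).delete {e}) := by
    rw [contract_delete_comm _ (by simpa using he.1.symm)]; exact (ih f).2
  by_cases hx : x = e
  · subst hx
    exact ⟨hr, .loop _ f he.contract_isLoop (by rwa [he.contract_delete])⟩
  by_cases hxf : x = f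
  · subst hxf
    refine ⟨?_, .loop _ e he.symm.contract_isLoop hfe⟩
    rw [he.delete_right]
    exact hr.map _
  refine ⟨.par _ e f (he.delete hx hxf) ?_, ?_⟩
  · rw [delete_comm]; exact (ih x).1
  have hxr : IsReducible ((M.contract {x}).delete {e}) := by
    rw [contract_delete_comm _ (by simpa using hx)]; exact (ih x).2
  by_cases hl : (M.contract {x}).IsLoop e
  · exact .loop _ e hl hxr
  · exact .par _ e f (he.contract hx hxf hl) hxr

theorem IsReducible.delete_contract {M : Matroid α} (h : IsReducible M) (x : α) :
    IsReducible (M.delete {x}) ∧ IsReducible (M.contract {x}) := by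
  have dualize : ∀ {N : Matroid α}, (∀ x, IsReducible (N.delete {x}) ∧ IsReducible (N.contract {x}))
      → ∀ x, IsReducible (N✶.delete {x}) ∧ IsReducible (N✶.contract {x}) := by
    intro N hN x
    rw [← dual_contract, ← dual_delete]
    exact ⟨(hN x).2.dual, (hN x).1.dual⟩
  induction h generalizing x with
  | empty M h => exact ⟨.empty _ (by simp [h]), .empty _ (by simp [h])⟩
  | loop M e he hr ih => exact isReducible_minors_of_loop he hr ih x
  | coloop M e he hr ih =>
    have := dualize (isReducible_minors_of_loop (M := M✶) he (by rw [← dual_contract]; exact hr.dual)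
      (by rw [← dual_contract]; exact dualize ih)) x
    simpa using this
  | par M e f he hr ih => exact isReducible_minors_of_par he hr ih x
  | ser M e f he hr ih =>
    have := dualize (isReducible_minors_of_par (M := M✶) he (by rw [← dual_contract]; exact hr.dual)
      (by rw [← dual_contract]; exact dualize ih)) x
    simpa using this

theorem IsReducible.delete [Finite α] {M : Matroid α} (h : IsReducible M) (D : Set α) :
    IsReducible (M.delete D) := by
  induction D, toFinite D using Set.Finite.induction_on with
  | empty => simpa
  | insert _ _ ih =>
    rw [insert_eq, union_comm, ← delete_delete]
    exact (ih.delete_contract _).1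

theorem IsReducible.restrict [Finite α] {M : Matroid α} (h : IsReducible M) {R : Set α}
    (hR : R ⊆ M.E) : IsReducible (M.restrict R) := by
  rw [← delete_compl hR]
  exact h.delete _

end Reducible

section SeriesParallel

theorem IsSeriesParallel.nonempty {M : Matroid α} (h : IsSeriesParallel M) : M.E.Nonempty := by
  induction h with
  | loop e => simp
  | coloop e => simp
  | parallel M M' _ hext ih =>
    obtain ⟨e, f, he, -⟩ := isParallelExtension_iff.1 hext
    exact ⟨e, he.left_mem⟩
  | series M M' _ hext ih =>
    obtain ⟨e, f, he, -⟩ := isSeriesExtension_iff.1 hext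
    exact ⟨e, he.left_mem⟩

theorem IsSeriesParallel.dual {M : Matroid α} (h : IsSeriesParallel M) : IsSeriesParallel M✶ := by
  induction h with
  | loop e => simpa using IsSeriesParallel.coloop e
  | coloop e => simpa using IsSeriesParallel.loop e
  | parallel M M' _ hext ih =>
    obtain ⟨e, f, he, rfl⟩ := isParallelExtension_iff.1 hext
    exact .series _ _ ih (isSeriesExtension_iff.2 ⟨e, f, ser_dual.2 he, (dual_delete _ _).symm⟩)
  | series M M' _ hext ih =>
    obtain ⟨e, f, he, rfl⟩ := isSeriesExtension_iff.1 hext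
    exact .parallel _ _ ih (isParallelExtension_iff.2 ⟨e, f, par_dual.2 he, (dual_contract _ _).symm⟩)

theorem isSeriesParallel_dual_iff {M : Matroid α} : IsSeriesParallel M✶ ↔ IsSeriesParallel M :=
  ⟨fun h => by simpa using h.dual, IsSeriesParallel.dual⟩

theorem IsSeriesParallel.map {M : Matroid α} (h : IsSeriesParallel M) {σ : α → β}
    (hσ : InjOn σ M.E) : IsSeriesParallel (M.map σ hσ) := by
  induction h with
  | loop e => simpa using IsSeriesParallel.loop (σ e)
  | coloop e => simpa using IsSeriesParallel.coloop (σ e)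
  | parallel M M' _ hext ih =>
    obtain ⟨e, f, he, rfl⟩ := isParallelExtension_iff.1 hext
    exact .parallel _ _ (ih (hσ.mono sdiff_subset)) (isParallelExtension_iff.2
      ⟨σ e, σ f, he.map hσ, map_delete_singleton he.left_mem hσ⟩)
  | series M M' _ hext ih =>
    obtain ⟨e, f, he, rfl⟩ := isSeriesExtension_iff.1 hext
    exact .series _ _ (ih (hσ.mono sdiff_subset)) (isSeriesExtension_iff.2
      ⟨σ e, σ f, he.map hσ, map_contract_singleton he.left_mem hσ⟩)

theorem isSeriesParallel_map_iff {M : Matroid α} {σ : α → β} (hσ : σ.Injective) :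
    IsSeriesParallel (M.map σ hσ.injOn) ↔ IsSeriesParallel M := by
  refine ⟨fun h => ?_, fun h => h.map _⟩
  obtain ⟨_, ⟨x, -, rfl⟩⟩ := h.nonempty
  have : Nonempty α := ⟨x⟩
  have hg : LeftInvOn (Function.invFun σ) σ M.E :=
    fun y _ => Function.leftInverse_invFun hσ y
  have hgi : InjOn (Function.invFun σ) (M.map σ hσ.injOn).E := by
    rw [map_ground]
    rintro _ ⟨y, hy, rfl⟩ _ ⟨z, hz, rfl⟩ hyz
    rw [hg hy, hg hz] at hyz
    rw [hyz]
  have := h.map hgi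
  rwa [map_map_of_leftInvOn M hσ.injOn hg] at this

theorem IsSeriesParallel.conn [Finite α] {M : Matroid α} (h : IsSeriesParallel M) : Conn M := by
  induction h with
  | loop e => rintro _ rfl _ rfl; exact Linked.refl _ _
  | coloop e => rintro _ rfl _ rfl; exact Linked.refl _ _
  | parallel M M' _ hext ih =>
    obtain ⟨e, f, he, rfl⟩ := isParallelExtension_iff.1 hext
    exact he.conn_delete_iff.1 ih
  | series M M' _ hext ih =>
    obtain ⟨e, f, he, rfl⟩ := isSeriesExtension_iff.1 hext
    exact he.conn_contract_iff.1 ih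

theorem IsSeriesParallel.isReducible {M : Matroid α} (h : IsSeriesParallel M) :
    IsReducible M := by
  induction h with
  | loop e => exact .loop _ e (by simp) (.empty _ (by simp))
  | coloop e =>
    refine .coloop _ e ?_ (.empty _ (by simp))
    rw [← dual_isLoop_iff_isColoop]; simp
  | parallel M M' _ hext ih =>
    obtain ⟨e, f, he, rfl⟩ := isParallelExtension_iff.1 hext
    exact .par _ e f he ih
  | series M M' _ hext ih =>
    obtain ⟨e, f, he, rfl⟩ := isSeriesExtension_iff.1 hext
    exact .ser _ e f he ih

theorem eq_singleton_of_conn_of_isLoop {M : Matroid α} {e : α} (hc : Conn M) (he : M.IsLoop e) :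
    M.E = {e} := by
  ext x
  constructor
  · intro hx
    by_contra hxe
    exact (hc.isNonloop he.mem_ground hx (Ne.symm hxe)).not_isLoop he
  · rintro rfl; exact he.mem_ground

theorem eq_singleton_of_conn_of_isColoop {M : Matroid α} {e : α} (hc : Conn M)
    (he : M.IsColoop e) : M.E = {e} := by
  ext x
  constructor
  · intro hx
    by_contra hxe
    rcases hc e he.mem_ground x hx with h | ⟨C, hC, heC, -⟩
    · exact hxe h
    · exact he.notMem_isCircuit hC heC
  · rintro rfl; exact he.mem_ground

theorem isSeriesParallel_of_isLoop {M : Matroid α} {e : α} (hE : M.E = {e}) (he : M.IsLoop e) :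
    IsSeriesParallel M := by
  have : M = loopyOn {e} := eq_loopyOn_iff_loops.2
    ⟨(hE ▸ M.loops_subset_ground).antisymm (singleton_subset_iff.2 he), hE⟩
  rw [this]
  exact .loop e

theorem IsReducible.isSeriesParallel [Finite α] {M : Matroid α} (h : IsReducible M) (hc : Conn M)
    (hne : M.E.Nonempty) : IsSeriesParallel M := by
  induction h with
  | empty M h => simp [h] at hne
  | loop M e he _ ih =>
    exact isSeriesParallel_of_isLoop (eq_singleton_of_conn_of_isLoop hc he) he
  | coloop M e he _ ih =>
    exact isSeriesParallel_dual_iff.1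
      (isSeriesParallel_of_isLoop (M := M✶) (eq_singleton_of_conn_of_isColoop (M := M) hc he) he)
  | par M e f he _ ih =>
    exact .parallel _ _ (ih (he.conn_delete_iff.2 hc) ⟨f, he.right_mem, he.1.symm⟩)
      (isParallelExtension_iff.2 ⟨e, f, he, rfl⟩)
  | ser M e f he _ ih =>
    exact .series _ _ (ih (he.conn_contract_iff.2 hc) ⟨f, he.right_mem, he.1.symm⟩)
      (isSeriesExtension_iff.2 ⟨e, f, he, rfl⟩)

theorem isSeriesParallel_iff [Finite α] {M : Matroid α} :
    IsSeriesParallel M ↔ M.E.Nonempty ∧ Conn M ∧ IsReducible M :=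
  ⟨fun h => ⟨h.nonempty, h.conn, h.isReducible⟩, fun h => h.2.2.isSeriesParallel h.2.1 h.1⟩

theorem Par.isSeriesParallel_delete_iff [Finite α] {M : Matroid α} {e f : α} (h : Par M e f) :
    IsSeriesParallel (M.delete {e}) ↔ IsSeriesParallel M := by
  rw [isSeriesParallel_iff, isSeriesParallel_iff, h.conn_delete_iff]
  exact ⟨fun h' => ⟨⟨e, h.left_mem⟩, h'.2.1, .par _ e f h h'.2.2⟩,
    fun h' => ⟨⟨f, h.right_mem, h.1.symm⟩, h'.2.1, (h'.2.2.delete_contract e).1⟩⟩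

theorem Ser.isSeriesParallel_contract_iff [Finite α] {M : Matroid α} {e f : α} (h : Ser M e f) :
    IsSeriesParallel (M.contract {e}) ↔ IsSeriesParallel M := by
  rw [← isSeriesParallel_dual_iff, dual_contract, Par.isSeriesParallel_delete_iff (M := M✶) h,
    isSeriesParallel_dual_iff]

theorem IsSeriesParallel.exists_par_or_ser {M : Matroid α} (h : IsSeriesParallel M)
    (hnt : M.E.Nontrivial) : ∃ e f, Par M e f ∨ Ser M e f := by
  cases h with
  | loop e => simp at hnt
  | coloop e => simp at hnt
  | parallel M M' _ hext =>
    obtain ⟨e, f, he, rfl⟩ := isParallelExtension_iff.1 hext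
    exact ⟨e, f, Or.inl he⟩
  | series M M' _ hext =>
    obtain ⟨e, f, he, rfl⟩ := isSeriesExtension_iff.1 hext
    exact ⟨e, f, Or.inr he⟩

end SeriesParallel

section Rooted

theorem par_of_conn_of_ground_eq_pair {M : Matroid α} {f x : α} (hc : Conn M) (hE : M.E = {f, x})
    (hfx : f ≠ x) : Par M f x := by
  rcases hc f (by simp [hE]) x (by simp [hE]) with h | ⟨C, hC, hf, hx⟩
  · exact absurd h.symm hfx
  · have : C = {f, x} := (hE ▸ hC.subset_ground).antisymm
      (insert_subset hf (singleton_subset_iff.2 hx))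
    exact ⟨hfx, this ▸ hC⟩

theorem ncard_delete_singleton [Finite α] {M : Matroid α} {e : α} (he : e ∈ M.E) :
    (M.delete {e}).E.ncard = M.E.ncard - 1 := ncard_sdiff_singleton_of_mem he

theorem IsReducible.conn_dual_iff [Finite α] {M : Matroid α} (h : IsReducible M) :
    Conn M✶ ↔ Conn M := by
  rcases eq_empty_or_nonempty M.E with hE | hE
  · simp [Conn, hE]
  · exact ⟨fun hc => by simpa using (h.dual.isSeriesParallel hc hE).dual.conn,
      fun hc => (h.isSeriesParallel hc hE).dual.conn⟩

theorem Par.dichotomy_of_delete [Finite α] {M : Matroid α} (hM : IsSeriesParallel M) {x e f : α}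
    (hx : x ∈ M.E) (_ : 3 ≤ M.E.ncard) (hnp : ∀ e, ¬ Par M e x) (hef : Par M e f) (hex : e ≠ x)
    (hfx : f ≠ x)
    (ih : 3 ≤ (M.delete {e}).E.ncard →
      (Conn ((M.delete {e}).contract {x}) ↔ ¬ Conn ((M.delete {e}).delete {x}))) :
    Conn (M.contract {x}) ↔ ¬ Conn (M.delete {x}) := by
  have hM' := hef.isSeriesParallel_delete_iff.2 hM
  have hcard : 3 ≤ (M.delete {e}).E.ncard := by
    by_contra hlt
    have h2 : ({f, x} : Set α) ⊆ (M.delete {e}).E := by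
      rintro _ (rfl | rfl)
      exacts [⟨hef.right_mem, hef.1.symm⟩, ⟨hx, hex.symm⟩]
    have hE := eq_of_subset_of_ncard_le h2 (by rw [ncard_pair hfx]; omega)
    exact hnp f (par_of_conn_of_ground_eq_pair hM'.conn hE.symm hfx).of_delete
  have hl : ¬ (M.contract {x}).IsLoop e := by
    rw [contract_isLoop_iff_mem_closure]
    rintro ⟨hcl, -⟩
    have hce := hef.isNonloop.closure_eq_of_mem_closure hcl
    exact hnp e (par_of_closure_eq hef.isNonloop hex hce)
  have h1 := (hef.delete hex.symm hfx.symm).conn_delete_iff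
  have h2 := (hef.contract hex.symm hfx.symm hl).conn_delete_iff
  rw [delete_comm] at h1
  rw [contract_delete_comm _ (by simpa using hex.symm)] at h2
  rw [← h1, ← h2]
  exact ih hcard

theorem Par.not_conn_contract {M : Matroid α} {e x : α} (h : Par M e x)
    (h3 : 3 ≤ M.E.ncard) : ¬ Conn (M.contract {x}) := by
  intro hc
  have hE := eq_singleton_of_conn_of_isLoop hc h.symm.contract_isLoop
  rw [contract_ground] at hE
  have : M.E ⊆ {e, x} := by
    intro z hz
    by_cases hzx : z = x
    · simp [hzx]
    · have : z ∈ M.E \ {x} := ⟨hz, hzx⟩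
      rw [hE] at this
      exact Or.inl this
  have := ncard_le_ncard this
  rw [ncard_pair h.1] at this
  omega

/-- For a series-parallel matroid on at least three elements, exactly one of the contraction and
the deletion of an element is connected. -/
theorem IsSeriesParallel.conn_contract_iff_not_conn_delete [Finite α] {M : Matroid α}
    (hM : IsSeriesParallel M) {x : α} (hx : x ∈ M.E) (h3 : 3 ≤ M.E.ncard) :
    Conn (M.contract {x}) ↔ ¬ Conn (M.delete {x}) := by
  obtain ⟨n, hn⟩ : ∃ n, M.E.ncard = n := ⟨_, rfl⟩
  induction n using Nat.strong_induction_on generalizing M with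
  | _ n ih =>
  by_cases hA : ∃ e, Par M e x
  · obtain ⟨e, he⟩ := hA
    exact iff_of_false (he.not_conn_contract h3) (not_not.2 (he.symm.conn_delete_iff.2 hM.conn))
  by_cases hB : ∃ e, Ser M e x
  · obtain ⟨e, he⟩ := hB
    refine iff_of_true (he.symm.conn_contract_iff.2 hM.conn) ?_
    have := Par.not_conn_contract (M := M✶) he h3
    rwa [← dual_delete, (hM.isReducible.delete_contract x).1.conn_dual_iff] at this
  push Not at hA hB
  obtain ⟨e, f, hef⟩ := hM.exists_par_or_ser
    ((one_lt_ncard_iff_nontrivial (s := M.E)).1 (by omega))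
  rcases hef with hef | hef
  · have hex : e ≠ x := fun h => hA f (h ▸ hef.symm)
    have hfx : f ≠ x := fun h => hA e (h ▸ hef)
    exact hef.dichotomy_of_delete hM hx h3 hA hex hfx fun h =>
      ih _ (by rw [ncard_delete_singleton hef.left_mem]; omega)
        (hef.isSeriesParallel_delete_iff.2 hM) ⟨hx, hex.symm⟩ h rfl
  · have hex : e ≠ x := fun h => hB f (h ▸ hef.symm)
    have hfx : f ≠ x := fun h => hB e (h ▸ hef)
    have hef' : Par M✶ e f := hef
    have := hef'.dichotomy_of_delete hM.dual hx h3 hB hex hfx fun h =>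
      ih _ (by rw [ncard_delete_singleton (M := M✶) hef.left_mem, dual_ground]; omega)
        (hef'.isSeriesParallel_delete_iff.2 hM.dual) ⟨hx, hex.symm⟩ h rfl
    rw [← dual_delete, ← dual_contract, (hM.isReducible.delete_contract x).1.conn_dual_iff,
      (hM.isReducible.delete_contract x).2.conn_dual_iff] at this
    rw [this, not_not]

theorem Ser.of_delete_par {M : Matroid α} {e x g h : α} (hex : Par M e x)
    (hgh : Ser (M.delete {e}) g h) (hg : g ≠ x) (hh : h ≠ x) : Ser M g h := by
  refine ⟨hgh.1, ?_⟩
  have h1 : (M✶.contract {e}).IsCircuit {g, h} := by rw [← dual_delete]; exact hgh.2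
  obtain ⟨C, hC, hsub, hsup⟩ := h1.exists_subset_isCircuit_of_contract
  have heC : e ∉ C := by
    intro he
    have hx : x ∈ C := Ser.mem_of_mem (M := M✶) (ser_dual.2 hex) hC he
    rcases hsup hx with (h | h) | h
    exacts [hg h.symm, hh h.symm, hex.1 h.symm]
  have : C = {g, h} := subset_antisymm
    (fun z hz => (hsup hz).resolve_right fun h => heC (h ▸ hz)) hsub
  exact this ▸ hC

/-- A series-parallel matroid on at least three elements has a parallel or series pair avoiding
any prescribed element. -/
theorem IsSeriesParallel.exists_par_or_ser_avoiding [Finite α] {M : Matroid α}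
    (hM : IsSeriesParallel M) {x : α} (hx : x ∈ M.E) (h3 : 3 ≤ M.E.ncard) :
    ∃ e f, e ≠ x ∧ f ≠ x ∧ (Par M e f ∨ Ser M e f) := by
  obtain ⟨n, hn⟩ : ∃ n, M.E.ncard = n := ⟨_, rfl⟩
  induction n using Nat.strong_induction_on generalizing M with
  | _ n ih =>
  have key : ∀ {N : Matroid α}, IsSeriesParallel N → x ∈ N.E → N.E.ncard = n → ∀ e, Par N e x →
      ∃ e f, e ≠ x ∧ f ≠ x ∧ (Par N e f ∨ Ser N e f) := by
    intro N hN hxN hnN e he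
    have hN' := he.isSeriesParallel_delete_iff.2 hN
    have hxN' : x ∈ (N.delete {e}).E := ⟨hxN, he.1.symm⟩
    have hcard := ncard_delete_singleton he.left_mem
    by_cases h : 3 ≤ (N.delete {e}).E.ncard
    · obtain ⟨g, k, hg, hk, hgk⟩ := ih _ (by omega) hN' hxN' h rfl
      exact ⟨g, k, hg, hk, hgk.imp Par.of_delete fun h => Ser.of_delete_par he h hg hk⟩
    · obtain ⟨g, hg, hgx⟩ := exists_ne_of_one_lt_ncard (s := (N.delete {e}).E) (by omega) x
      have hE : (N.delete {e}).E = {g, x} := (eq_of_subset_of_ncard_le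
        (insert_subset hg (singleton_subset_iff.2 hxN')) (by rw [ncard_pair hgx]; omega)).symm
      have hp := (par_of_conn_of_ground_eq_pair hN'.conn hE hgx).of_delete
      exact ⟨e, g, he.1, hgx, Or.inl (he.trans hp.symm (Ne.symm hg.2))⟩
  have key' : ∀ e, Ser M e x → ∃ e f, e ≠ x ∧ f ≠ x ∧ (Par M e f ∨ Ser M e f) := by
    intro e he
    obtain ⟨g, k, hg, hk, h⟩ := key hM.dual hx hn e he
    exact ⟨g, k, hg, hk, h.symm.imp ser_dual.1 par_dual.1⟩
  obtain ⟨e, f, hef⟩ := hM.exists_par_or_ser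
    ((one_lt_ncard_iff_nontrivial (s := M.E)).1 (by omega))
  by_cases hex : e = x
  · subst hex
    rcases hef with h | h
    exacts [key hM hx hn f h.symm, key' f h.symm]
  by_cases hfx : f = x
  · subst hfx
    rcases hef with h | h
    exacts [key hM hx hn e h, key' e h]
  exact ⟨e, f, hex, hfx, hef⟩

end Rooted

section Separators

/-- Every circuit of `M` lies in `S` or avoids `S`. -/
def Separates (M : Matroid α) (S : Set α) : Prop :=
  ∀ C, M.IsCircuit C → C ⊆ S ∨ Disjoint C S

theorem component_subset_ground (M : Matroid α) (e : α) : component M e ⊆ M.E := fun _ h => h.1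

theorem mem_component_self {M : Matroid α} {e : α} (he : e ∈ M.E) : e ∈ component M e :=
  ⟨he, Or.inl rfl⟩

theorem Separates.compl {M : Matroid α} {S : Set α} (h : Separates M S) :
    Separates M (M.E \ S) := by
  intro C hC
  rcases h C hC with h | h
  · exact Or.inr (disjoint_sdiff_right.mono_left h)
  · exact Or.inl (subset_sdiff.2 ⟨hC.subset_ground, h⟩)

theorem separates_component [Finite α] (M : Matroid α) (e : α) :
    Separates M (component M e) := by
  intro C hC
  by_cases h : Disjoint C (component M e)
  · exact Or.inr h
  obtain ⟨z, hz, hz'⟩ := not_disjoint_iff.1 h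
  exact Or.inl fun w hw => ⟨hC.subset_ground hw, Linked.trans hz'.2 (Or.inr ⟨C, hC, hz, hw⟩)⟩

theorem conn_restrict_component [Finite α] {M : Matroid α} {e : α} (he : e ∈ M.E) :
    Conn (M.restrict (component M e)) := by
  refine conn_of_forall_linked (x := e) fun g hg => ?_
  rcases hg.2 with h | ⟨C, hC, heC, hgC⟩
  · exact Or.inl h
  refine Or.inr ⟨C, hC.isCircuit_restrict_of_subset ?_, heC, hgC⟩
  exact (separates_component M e C hC).resolve_right
    (not_disjoint_iff.2 ⟨e, heC, mem_component_self he⟩)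

theorem Conn.component_eq {M : Matroid α} (h : Conn M) {e : α} (he : e ∈ M.E) :
    component M e = M.E :=
  (component_subset_ground M e).antisymm fun f hf => ⟨hf, h e he f hf⟩

theorem component_eq_of_separates [Finite α] {M : Matroid α} {S : Set α} {e : α} (hS : S ⊆ M.E)
    (he : e ∈ S) (hsep : Separates M S) (hc : Conn (M.restrict S)) : component M e = S := by
  ext f
  constructor
  · rintro ⟨hf, rfl | ⟨C, hC, heC, hfC⟩⟩
    · exact he
    · exact (hsep C hC).resolve_right (not_disjoint_iff.2 ⟨e, heC, he⟩) hfC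
  · intro hf
    exact ⟨hS hf, (hc e he f hf).of_restrict hS⟩

theorem Separates.indep_iff {M : Matroid α} {S I : Set α} (h : Separates M S) (hI : I ⊆ M.E) :
    M.Indep I ↔ M.Indep (I ∩ S) ∧ M.Indep (I \ S) := by
  refine ⟨fun h => ⟨h.subset inter_subset_left, h.subset sdiff_subset⟩, fun ⟨h1, h2⟩ => ?_⟩
  rw [indep_iff_forall_subset_not_isCircuit hI]
  intro C hCI hC
  rcases h C hC with hCS | hCS
  · exact hC.not_indep (h1.subset (subset_inter hCI hCS))
  · exact hC.not_indep (h2.subset (subset_sdiff.2 ⟨hCI, hCS⟩))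

theorem separates_of_indep {M : Matroid α} {S : Set α}
    (h : ∀ I ⊆ M.E, M.Indep (I ∩ S) → M.Indep (I \ S) → M.Indep I) : Separates M S := by
  intro C hC
  by_contra hno
  push Not at hno
  refine hC.not_indep (h C hC.subset_ground (hC.ssubset_indep ?_) (hC.ssubset_indep ?_))
  · exact ⟨inter_subset_left, fun hss => hno.1 (hss.trans inter_subset_right)⟩
  · exact ⟨sdiff_subset, fun hss => hno.2 (disjoint_left.2 fun z hz => (hss hz).2)⟩

theorem restrict_insert_contract {M : Matroid α} {x : α} {S : Set α} (hx : x ∉ S) :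
    (M.restrict (insert x S)).contract {x} = (M.contract {x}).restrict S := by
  rw [restrict_contract_eq_contract_restrict _ (by simp)]
  congr 1
  simp [hx]

theorem conn_restrict_insert [Finite α] {M : Matroid α} (hc : Conn M) {x : α} {S : Set α}
    (hx : x ∈ M.E) (hSE : S ⊆ M.E) (hS : Separates (M.contract {x}) S) :
    Conn (M.restrict (insert x S)) := by
  refine conn_of_forall_linked (x := x) fun g hg => ?_
  by_cases hgx : g = x
  · exact Or.inl hgx
  have hgS : g ∈ S := hg.resolve_left hgx
  rcases hc x hx g (hSE hgS) with h | ⟨C, hC, hxC, hgC⟩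
  · exact Or.inl h
  refine Or.inr ⟨C, hC.isCircuit_restrict_of_subset fun z hz => ?_, hxC, hgC⟩
  by_cases hzx : z = x
  · exact Or.inl hzx
  have hC' := hC.contractElem_isCircuit ⟨x, hxC, g, hgC, Ne.symm hgx⟩ hxC
  exact Or.inr ((hS _ hC').resolve_right (not_disjoint_iff.2 ⟨g, ⟨hgC, hgx⟩, hgS⟩) ⟨hz, hzx⟩)

end Separators

section ParallelConnection

/-- `P` is the parallel connection of `N₁` and `N₂` along their only common element `x`. -/
structure IsParConn (x : α) (N₁ N₂ P : Matroid α) : Prop where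
  inter_eq : N₁.E ∩ N₂.E = {x}
  left_isNonloop : N₁.IsNonloop x
  right_isNonloop : N₂.IsNonloop x
  ground_eq : P.E = N₁.E ∪ N₂.E
  indep_iff : ∀ I, P.Indep I ↔ I ⊆ N₁.E ∪ N₂.E ∧
    ((N₁.Indep (insert x (I ∩ N₁.E)) ∧ N₂.Indep (I ∩ N₂.E)) ∨
      (N₁.Indep (I ∩ N₁.E) ∧ N₂.Indep (insert x (I ∩ N₂.E))))

/-- `B` is obtained by gluing bases `B₁`, `B₂` of `N₁`, `N₂`, at least one of which contains `x`;
the result contains `x` if both do. -/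
def IsGlued (x : α) (N₁ N₂ : Matroid α) (B₁ B₂ B : Set α) : Prop :=
  N₁.IsBase B₁ ∧ N₂.IsBase B₂ ∧ (x ∈ B₁ ∨ x ∈ B₂) ∧
    ∀ z, z ∈ B ↔ (z = x ∧ x ∈ B₁ ∧ x ∈ B₂) ∨ (z ≠ x ∧ (z ∈ B₁ ∨ z ∈ B₂))

theorem IsGlued.symm {x : α} {N₁ N₂ : Matroid α} {B₁ B₂ B : Set α} (h : IsGlued x N₁ N₂ B₁ B₂ B) :
    IsGlued x N₂ N₁ B₂ B₁ B :=
  ⟨h.2.1, h.1, h.2.2.1.symm, fun z => by rw [h.2.2.2 z]; tauto⟩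

theorem IsGlued.exchange_left {x : α} {N₁ N₂ : Matroid α} (hE : N₁.E ∩ N₂.E = {x})
    {B₁ B₂ B B₁' B₂' B' : Set α} (h : IsGlued x N₁ N₂ B₁ B₂ B) (h' : IsGlued x N₁ N₂ B₁' B₂' B')
    {a : α} (ha : a ∈ B₁ \ B₁') (haB : a ∈ B) :
    ∃ y ∈ B' \ B, ∃ C₁ C₂, IsGlued x N₁ N₂ C₁ C₂ (insert y (B \ {a})) := by
  obtain ⟨hB₁, hB₂, hx, hB⟩ := h
  obtain ⟨hB₁', hB₂', hx', hB'⟩ := h'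
  have hd : ∀ z, z ≠ x → z ∈ N₁.E → z ∉ N₂.E := fun z hz h1 h2 => hz (hE.subset ⟨h1, h2⟩)
  have hs₁ := hB₁.subset_ground
  have hs₂ := hB₂.subset_ground
  have hs₁' := hB₁'.subset_ground
  have hs₂' := hB₂'.subset_ground
  obtain ⟨y, hy, hyB⟩ := hB₁.exchange hB₁' ha
  by_cases hyx : y = x
  · subst hyx
    have hyB₂ : y ∈ B₂ := hx.resolve_left hy.2
    have hay : a ≠ y := fun h => hy.2 (h ▸ ha.1)
    have ha₂ : a ∉ B₂ := fun h => hd a hay (hs₁ ha.1) (hs₂ h)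
    by_cases hyB₂' : y ∈ B₂'
    · refine ⟨y, ⟨(hB' y).2 (Or.inl ⟨rfl, hy.1, hyB₂'⟩), fun h => ?_⟩, _, _, hyB, hB₂, Or.inl (by simp),
        fun z => ?_⟩
      · have := (hB y).1 h
        have := hy.2
        tauto
      · by_cases hzy : z = y
        · simp [hzy, hyB₂]
        · by_cases hza : z = a
          · subst hza; simp [hzy, ha₂]
          · simp [hzy, hza, hB z]
    · obtain ⟨z, hz, hzB⟩ := hB₂.exchange hB₂' ⟨hyB₂, hyB₂'⟩
      have hzy : z ≠ y := fun h => hyB₂' (h ▸ hz.1)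
      have hz₁ : z ∉ B₁ := fun h => hd z hzy (hs₁ h) (hs₂' hz.1)
      refine ⟨z, ⟨(hB' z).2 (Or.inr ⟨hzy, Or.inr hz.1⟩), fun h => ?_⟩, _, _, hyB, hzB,
        Or.inl (by simp), fun w => ?_⟩
      · rcases (hB z).1 h with h | ⟨-, h | h⟩
        exacts [hzy h.1, hz₁ h, hz.2 h]
      · by_cases hwy : w = y
        · subst hwy
          have : w ∉ B := fun h => by
            have := (hB w).1 h
            have := hy.2
            tauto
          simp [this, hzy.symm]
        · by_cases hwz : w = z
          · simp [hwz, hzy]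
          · by_cases hwa : w = a
            · subst hwa; simp [hwz, hwy, ha₂]
            · simp [hwy, hwz, hwa, hB w]
  · have hyB₂ : y ∉ B₂ := fun h => hd y hyx (hs₁' hy.1) (hs₂ h)
    by_cases hax : a = x
    · subst hax
      have ha₂ : a ∈ B₂ := by
        have := (hB a).1 haB
        tauto
      refine ⟨y, ⟨(hB' y).2 (Or.inr ⟨hyx, Or.inl hy.1⟩), fun h => ?_⟩, _, _, hyB, hB₂, Or.inr ha₂,
        fun z => ?_⟩
      · rcases (hB y).1 h with h | ⟨-, h | h⟩
        exacts [hyx h.1, hy.2 h, hyB₂ h]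
      · by_cases hzy : z = y
        · simp [hzy, hyx]
        · by_cases hza : z = a
          · subst hza; simp [hzy]
          · simp [hzy, hza, hB z]
    · have ha₂ : a ∉ B₂ := fun h => hd a hax (hs₁ ha.1) (hs₂ h)
      refine ⟨y, ⟨(hB' y).2 (Or.inr ⟨hyx, Or.inl hy.1⟩), fun h => ?_⟩, _, _, hyB, hB₂, ?_,
        fun z => ?_⟩
      · rcases (hB y).1 h with h | ⟨-, h | h⟩
        exacts [hyx h.1, hy.2 h, hyB₂ h]
      · simpa [Ne.symm hyx, Ne.symm hax] using hx
      · by_cases hzy : z = y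
        · simp [hzy, hyx]
        · by_cases hza : z = a
          · subst hza; simp [hzy, hax, ha₂]
          · by_cases hzx : z = x
            · subst hzx; simp [hzy, hza, hB z]
            · simp [hzy, hza, hzx, hB z]

theorem exists_isParConn [Finite α] {x : α} {N₁ N₂ : Matroid α} (hE : N₁.E ∩ N₂.E = {x})
    (h₁ : N₁.IsNonloop x) (h₂ : N₂.IsNonloop x) : ∃ P, IsParConn x N₁ N₂ P := by
  have hd : ∀ z, z ∈ N₁.E → z ∈ N₂.E → z = x := fun z h1 h2 => hE.subset ⟨h1, h2⟩
  let P : Matroid α := Matroid.ofIsBaseOfFinite (E := N₁.E ∪ N₂.E) (toFinite _)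
    (fun B => ∃ B₁ B₂, IsGlued x N₁ N₂ B₁ B₂ B)
    (by
      obtain ⟨B₁, hB₁, hx₁⟩ := h₁.exists_mem_isBase
      obtain ⟨B₂, hB₂⟩ := N₂.exists_isBase
      exact ⟨{z | (z = x ∧ x ∈ B₁ ∧ x ∈ B₂) ∨ (z ≠ x ∧ (z ∈ B₁ ∨ z ∈ B₂))}, B₁, B₂, hB₁, hB₂,
        Or.inl hx₁, fun z => Iff.rfl⟩)
    (by
      rintro B B' ⟨B₁, B₂, h⟩ ⟨B₁', B₂', h'⟩ a ha
      have key : a ∈ B₁ \ B₁' ∨ a ∈ B₂ \ B₂' := by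
        have h1 := (h.2.2.2 a).1 ha.1
        have h2 := mt (h'.2.2.2 a).2 ha.2
        simp only [mem_sdiff]
        by_cases hax : a = x
        · subst hax; tauto
        · tauto
      rcases key with h1 | h1
      · exact h.exchange_left hE h' h1 ha.1
      · obtain ⟨y, hy, C₁, C₂, hC⟩ := h.symm.exchange_left (by rwa [inter_comm]) h'.symm h1 ha.1
        exact ⟨y, hy, C₂, C₁, hC.symm⟩)
    (by
      rintro B ⟨B₁, B₂, hB₁, hB₂, hx, hB⟩ z hz
      rcases (hB z).1 hz with ⟨rfl, h, -⟩ | ⟨-, h | h⟩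
      exacts [Or.inl (hB₁.subset_ground h), Or.inl (hB₁.subset_ground h),
        Or.inr (hB₂.subset_ground h)])
  refine ⟨P, hE, h₁, h₂, rfl, fun I => ?_⟩
  have hx₁ := h₁.mem_ground
  have hx₂ := h₂.mem_ground
  rw [Matroid.indep_iff]
  constructor
  · rintro ⟨B, ⟨B₁, B₂, hB₁, hB₂, hx, hB⟩, hIB⟩
    have hI₁ : I ∩ N₁.E ⊆ B₁ := by
      rintro z ⟨hz, hzE⟩
      rcases (hB z).1 (hIB hz) with ⟨rfl, h, -⟩ | ⟨hzx, h | h⟩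
      exacts [h, h, absurd (hd z hzE (hB₂.subset_ground h)) hzx]
    have hI₂ : I ∩ N₂.E ⊆ B₂ := by
      rintro z ⟨hz, hzE⟩
      rcases (hB z).1 (hIB hz) with ⟨rfl, -, h⟩ | ⟨hzx, h | h⟩
      exacts [h, absurd (hd z (hB₁.subset_ground h) hzE) hzx, h]
    refine ⟨fun z hz => ?_, ?_⟩
    · rcases (hB z).1 (hIB hz) with ⟨rfl, h, -⟩ | ⟨-, h | h⟩
      exacts [Or.inl (hB₁.subset_ground h), Or.inl (hB₁.subset_ground h),
        Or.inr (hB₂.subset_ground h)]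
    · rcases hx with hx | hx
      · exact Or.inl ⟨hB₁.indep.subset (insert_subset hx hI₁), hB₂.indep.subset hI₂⟩
      · exact Or.inr ⟨hB₁.indep.subset hI₁, hB₂.indep.subset (insert_subset hx hI₂)⟩
  · rintro ⟨hI, h⟩
    obtain ⟨B₁, B₂, hB₁, hB₂, hx, hI₁, hI₂⟩ : ∃ B₁ B₂, N₁.IsBase B₁ ∧ N₂.IsBase B₂ ∧
        (x ∈ B₁ ∨ x ∈ B₂) ∧ I ∩ N₁.E ⊆ B₁ ∧ I ∩ N₂.E ⊆ B₂ := by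
      rcases h with ⟨h1, h2⟩ | ⟨h1, h2⟩
      all_goals
        obtain ⟨B₁, hB₁, hI₁⟩ := h1.exists_isBase_superset
        obtain ⟨B₂, hB₂, hI₂⟩ := h2.exists_isBase_superset
      · exact ⟨B₁, B₂, hB₁, hB₂, Or.inl (hI₁ (by simp)), (subset_insert _ _).trans hI₁, hI₂⟩
      · exact ⟨B₁, B₂, hB₁, hB₂, Or.inr (hI₂ (by simp)), hI₁, (subset_insert _ _).trans hI₂⟩
    refine ⟨{z | (z = x ∧ x ∈ B₁ ∧ x ∈ B₂) ∨ (z ≠ x ∧ (z ∈ B₁ ∨ z ∈ B₂))},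
      ⟨B₁, B₂, hB₁, hB₂, hx, fun z => Iff.rfl⟩, fun z hz => ?_⟩
    by_cases hzx : z = x
    · subst hzx
      exact Or.inl ⟨rfl, hI₁ ⟨hz, hx₁⟩, hI₂ ⟨hz, hx₂⟩⟩
    · exact Or.inr ⟨hzx, (hI hz).imp (fun h => hI₁ ⟨hz, h⟩) fun h => hI₂ ⟨hz, h⟩⟩

variable {x : α} {N₁ N₂ P : Matroid α}

theorem IsParConn.symm (h : IsParConn x N₁ N₂ P) : IsParConn x N₂ N₁ P where
  inter_eq := by rw [inter_comm]; exact h.inter_eq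
  left_isNonloop := h.right_isNonloop
  right_isNonloop := h.left_isNonloop
  ground_eq := by rw [union_comm]; exact h.ground_eq
  indep_iff I := by rw [h.indep_iff, union_comm]; tauto

theorem IsParConn.notMem_right (h : IsParConn x N₁ N₂ P) {e : α} (he : e ∈ N₁.E) (hex : e ≠ x) :
    e ∉ N₂.E := fun h' => hex (h.inter_eq.subset ⟨he, h'⟩)

theorem IsParConn.restrict_left (h : IsParConn x N₁ N₂ P) : P.restrict N₁.E = N₁ := by
  refine ext_indep rfl fun I (hI : I ⊆ N₁.E) => ?_
  rw [restrict_indep_iff, h.indep_iff, inter_eq_left.2 hI]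
  have hI₂ : I ∩ N₂.E ⊆ {x} := fun z hz => h.inter_eq.subset ⟨hI hz.1, hz.2⟩
  constructor
  · rintro ⟨⟨-, h | h⟩, -⟩
    exacts [h.1.subset (subset_insert _ _), h.1]
  · intro hI'
    refine ⟨⟨hI.trans subset_union_left, Or.inr ⟨hI', h.right_isNonloop.indep.subset ?_⟩⟩, hI⟩
    exact insert_subset rfl hI₂

theorem IsParConn.restrict_right (h : IsParConn x N₁ N₂ P) : P.restrict N₂.E = N₂ :=
  h.symm.restrict_left

theorem IsParConn.left_subset (h : IsParConn x N₁ N₂ P) : N₁.E ⊆ P.E :=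
  h.ground_eq ▸ subset_union_left

theorem IsParConn.isCircuit_left (h : IsParConn x N₁ N₂ P) {C : Set α} (hC : N₁.IsCircuit C) :
    P.IsCircuit C := by
  rw [← h.restrict_left, restrict_isCircuit_iff h.left_subset] at hC
  exact hC.1

theorem IsParConn.linked_left (h : IsParConn x N₁ N₂ P) {e f : α} (hl : Linked N₁ e f) :
    Linked P e f := by
  rw [← h.restrict_left] at hl
  exact hl.of_restrict h.left_subset

theorem IsParConn.par_left (h : IsParConn x N₁ N₂ P) {e f : α} (hp : Par N₁ e f) : Par P e f :=
  ⟨hp.1, h.isCircuit_left hp.2⟩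

theorem IsParConn.conn [Finite α] (h : IsParConn x N₁ N₂ P) (h₁ : Conn N₁) (h₂ : Conn N₂) :
    Conn P := by
  refine conn_of_forall_linked (x := x) fun g hg => ?_
  rw [h.ground_eq] at hg
  rcases hg with hg | hg
  · exact h.linked_left (h₁ x h.left_isNonloop.mem_ground g hg)
  · exact h.symm.linked_left (h₂ x h.right_isNonloop.mem_ground g hg)

theorem IsParConn.delete_left (h : IsParConn x N₁ N₂ P) {e : α} (he : e ∈ N₁.E) (hex : e ≠ x) :
    IsParConn x (N₁.delete {e}) N₂ (P.delete {e}) := by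
  have he₂ := h.notMem_right he hex
  have hE : (N₁.delete {e}).E ∪ N₂.E = (N₁.E ∪ N₂.E) \ {e} := by
    rw [delete_ground, union_sdiff_distrib, sdiff_singleton_eq_self he₂]
  refine ⟨?_, ?_, h.right_isNonloop, ?_, fun I => ?_⟩
  · rw [delete_ground, ← h.inter_eq]
    ext z
    simp only [mem_inter_iff, mem_sdiff, mem_singleton_iff]
    constructor
    · tauto
    · rintro ⟨h1, h2⟩
      exact ⟨⟨h1, fun hz => he₂ (hz ▸ h2)⟩, h2⟩
  · exact delete_isNonloop_iff.2 ⟨h.left_isNonloop, hex.symm⟩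
  · rw [hE, delete_ground, h.ground_eq]
  · rw [deleteElem_indep_iff, h.indep_iff, hE, subset_sdiff, disjoint_singleton_right]
    have key : e ∉ I → I ∩ (N₁.delete {e}).E = I ∩ N₁.E := by
      intro heI
      ext z
      simp only [delete_ground, mem_inter_iff, mem_sdiff, mem_singleton_iff]
      exact ⟨fun h => ⟨h.1, h.2.1⟩, fun h => ⟨h.1, h.2, fun hz => heI (hz ▸ h.1)⟩⟩
    by_cases heI : e ∈ I
    · simp [heI]
    · rw [key heI]
      simp [heI, hex]

theorem IsParConn.contract_left (h : IsParConn x N₁ N₂ P) {e : α} (hex : e ≠ x)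
    (he : N₁.IsNonloop e) (hxe : (N₁.contract {e}).IsNonloop x) :
    IsParConn x (N₁.contract {e}) N₂ (P.contract {e}) := by
  have he₂ := h.notMem_right he.mem_ground hex
  have hE : (N₁.contract {e}).E ∪ N₂.E = (N₁.E ∪ N₂.E) \ {e} := by
    rw [contract_ground, union_sdiff_distrib, sdiff_singleton_eq_self he₂]
  have heP : P.IsNonloop e := by
    rw [← h.restrict_left] at he
    exact he.of_restrict
  refine ⟨?_, hxe, h.right_isNonloop, ?_, fun I => ?_⟩
  · rw [contract_ground, ← h.inter_eq]
    ext z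
    simp only [mem_inter_iff, mem_sdiff, mem_singleton_iff]
    constructor
    · tauto
    · rintro ⟨h1, h2⟩
      exact ⟨⟨h1, fun hz => he₂ (hz ▸ h2)⟩, h2⟩
  · rw [hE, contract_ground, h.ground_eq]
  · rw [heP.contractElem_indep_iff, h.indep_iff, hE, subset_sdiff, disjoint_singleton_right,
      he.contractElem_indep_iff, he.contractElem_indep_iff]
    have key : e ∉ I → I ∩ (N₁.contract {e}).E = I ∩ N₁.E := by
      intro heI
      ext z
      simp only [contract_ground, mem_inter_iff, mem_sdiff, mem_singleton_iff]
      exact ⟨fun h => ⟨h.1, h.2.1⟩, fun h => ⟨h.1, h.2, fun hz => heI (hz ▸ h.1)⟩⟩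
    by_cases heI : e ∈ I
    · simp [heI]
    · rw [key heI, insert_inter_of_mem he.mem_ground, insert_inter_of_notMem he₂, insert_comm]
      simp [heI, hex, insert_subset_iff, he.mem_ground]

end ParallelConnection

section SeriesPairs

theorem par_iff_isLoop_contract {M : Matroid α} {e f : α} (hef : e ≠ f) :
    Par M e f ↔ M.IsNonloop e ∧ M.IsNonloop f ∧ (M.contract {e}).IsLoop f := by
  refine ⟨fun h => ⟨h.isNonloop, h.symm.isNonloop, h.contract_isLoop⟩, fun ⟨he, hf, hl⟩ => ?_⟩
  exact (par_of_closure_eq hf hef.symm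
    (hf.closure_eq_of_mem_closure (contract_isLoop_iff_mem_closure.1 hl).1)).symm

theorem ser_iff_isColoop_delete {M : Matroid α} {e f : α} (hef : e ≠ f) (he : e ∈ M.E)
    (hf : f ∈ M.E) :
    Ser M e f ↔ ¬ M.IsColoop e ∧ ¬ M.IsColoop f ∧ (M.delete {e}).IsColoop f := by
  rw [← par_dual, par_iff_isLoop_contract hef, ← dual_delete, dual_isLoop_iff_isColoop,
    ← not_isLoop_iff (M := M✶) he, ← not_isLoop_iff (M := M✶) hf, dual_isLoop_iff_isColoop,
    dual_isLoop_iff_isColoop]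

theorem isColoop_iff_forall_insert_indep {M : Matroid α} {f : α} :
    M.IsColoop f ↔ ∀ I, M.Indep I → M.Indep (insert f I) := by
  refine ⟨fun h I hI => h.insert_indep_of_indep hI, fun h => ?_⟩
  rw [isColoop_iff_forall_mem_isBase]
  intro B hB
  rw [hB.eq_of_subset_indep (h B hB.indep) (subset_insert _ _)]
  simp

variable {x : α} {N₁ N₂ P : Matroid α}

theorem IsParConn.isColoop_left (h : IsParConn x N₁ N₂ P) {f : α} (hf : N₁.IsColoop f)
    (hfx : f ≠ x) : P.IsColoop f := by
  have hf₂ := h.notMem_right hf.mem_ground hfx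
  rw [isColoop_iff_forall_insert_indep] at hf ⊢
  intro I hI
  rw [h.indep_iff] at hI ⊢
  have hfE : f ∈ N₁.E := (hf ∅ N₁.empty_indep).subset_ground (by simp)
  rw [insert_inter_of_mem hfE, insert_inter_of_notMem hf₂, insert_comm]
  exact ⟨insert_subset (Or.inl hfE) hI.1,
    hI.2.imp (fun h => ⟨hf _ h.1, h.2⟩) fun h => ⟨hf _ h.1, h.2⟩⟩

theorem IsParConn.ser_left (h : IsParConn x N₁ N₂ P) {e f : α} (hs : Ser N₁ e f) (hex : e ≠ x)
    (hfx : f ≠ x) : Ser P e f := by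
  have hnc : ∀ {g}, g ∈ N₁.E → ¬ N₁.IsColoop g → ¬ P.IsColoop g := by
    intro g hg hgc hgP
    obtain ⟨C, hC, hgC⟩ := exists_mem_isCircuit_of_not_isColoop hg hgc
    exact hgP.notMem_isCircuit (h.isCircuit_left hC) hgC
  have he := hs.left_mem
  have hf := hs.right_mem
  obtain ⟨h1, h2, h3⟩ := (ser_iff_isColoop_delete hs.1 he hf).1 hs
  exact (ser_iff_isColoop_delete hs.1 (h.left_subset he) (h.left_subset hf)).2
    ⟨hnc he h1, hnc hf h2, (h.delete_left he hex).isColoop_left h3 hfx⟩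

theorem IsParConn.isReducible [Finite α] (h : IsParConn x N₁ N₂ P) (h₁ : IsSeriesParallel N₁)
    (h2 : 2 ≤ N₁.E.ncard) (h₂ : IsReducible N₂) : IsReducible P := by
  obtain ⟨n, hn⟩ : ∃ n, N₁.E.ncard = n := ⟨_, rfl⟩
  induction n using Nat.strong_induction_on generalizing N₁ P with
  | _ n ih =>
  have hx := h.left_isNonloop.mem_ground
  by_cases h3 : 3 ≤ N₁.E.ncard
  · obtain ⟨e, f, hex, hfx, hef | hef⟩ := h₁.exists_par_or_ser_avoiding hx h3
    · have hN := hef.isSeriesParallel_delete_iff.2 h₁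
      have hc := ncard_delete_singleton hef.left_mem
      exact .par _ e f (h.par_left hef)
        (ih _ (by omega) (h.delete_left hef.left_mem hex) hN (by omega) rfl)
    · have hN := hef.isSeriesParallel_contract_iff.2 h₁
      have hc := ncard_delete_singleton hef.left_mem
      have hxN : (N₁.contract {e}).IsNonloop x :=
        hN.conn.isNonloop ⟨hx, hex.symm⟩ ⟨hef.right_mem, hef.1.symm⟩ hfx.symm
      have hen : N₁.IsNonloop e := h₁.conn.isNonloop hef.left_mem hx hex
      refine .ser _ e f (h.ser_left hef hex hfx)
        (ih _ ?_ (h.contract_left hex hen hxN) hN ?_ rfl)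
      · rw [contract_ground, ← delete_ground]; omega
      · rw [contract_ground, ← delete_ground]; omega
  · obtain ⟨b, hb, hbx⟩ := exists_ne_of_one_lt_ncard (s := N₁.E) (by omega) x
    have hE : N₁.E = {b, x} := (eq_of_subset_of_ncard_le
      (insert_subset hb (singleton_subset_iff.2 hx)) (by rw [ncard_pair hbx]; omega)).symm
    have hp := h.par_left (par_of_conn_of_ground_eq_pair h₁.conn hE hbx)
    refine .par _ b x hp ?_
    have hPE : P.E \ {b} = N₂.E := by
      rw [h.ground_eq, hE, insert_union, insert_sdiff_of_mem _ (mem_singleton b), union_sdiff_distrib,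
        sdiff_singleton_eq_self (by simpa using hbx),
        sdiff_singleton_eq_self (h.notMem_right hb hbx)]
      exact union_eq_right.2 (singleton_subset_iff.2 h.right_isNonloop.mem_ground)
    rw [delete_eq_restrict, hPE, h.restrict_right]
    exact h₂

theorem IsParConn.isSeriesParallel [Finite α] (h : IsParConn x N₁ N₂ P)
    (h₁ : IsSeriesParallel N₁) (h2 : 2 ≤ N₁.E.ncard) (h₂ : IsSeriesParallel N₂) :
    IsSeriesParallel P :=
  (h.isReducible h₁ h2 h₂.isReducible).isSeriesParallel (h.conn h₁.conn h₂.conn)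
    ⟨x, h.left_subset h.left_isNonloop.mem_ground⟩

theorem IsParConn.separates_contract (h : IsParConn x N₁ N₂ P) :
    Separates (P.contract {x}) (N₁.E \ {x}) := by
  have hx₁ := h.left_isNonloop.mem_ground
  have hx₂ := h.right_isNonloop.mem_ground
  have hxP : P.IsNonloop x := by
    have := h.left_isNonloop
    rw [← h.restrict_left] at this
    exact this.of_restrict
  refine separates_of_indep fun I hI h1 h2 => ?_
  rw [hxP.contractElem_indep_iff, h.indep_iff] at h1 h2 ⊢
  obtain ⟨-, -, h1⟩ := h1
  obtain ⟨-, -, h2⟩ := h2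
  have hxI : x ∉ I := fun hx => (hI hx).2 rfl
  rw [contract_ground, h.ground_eq] at hI
  refine ⟨hxI, insert_subset (Or.inl hx₁) (hI.trans sdiff_subset), Or.inl ⟨?_, ?_⟩⟩
  · have hs : insert x (insert x I ∩ N₁.E) ⊆ insert x (I ∩ (N₁.E \ {x})) ∩ N₁.E := by
      intro z hz
      by_cases hzx : z = x
      · exact ⟨Or.inl hzx, hzx ▸ hx₁⟩
      · have := hz.resolve_left hzx
        exact ⟨Or.inr ⟨this.1.resolve_left hzx, this.2, hzx⟩, this.2⟩
    rcases h1 with h1 | h1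
    exacts [h1.1.subset (hs.trans (subset_insert _ _)), h1.1.subset hs]
  · have hs : insert x I ∩ N₂.E ⊆ insert x (I \ (N₁.E \ {x})) ∩ N₂.E := by
      rintro z ⟨hz, hz₂⟩
      by_cases hzx : z = x
      · exact ⟨Or.inl hzx, hz₂⟩
      · exact ⟨Or.inr ⟨hz.resolve_left hzx, fun h' => h.notMem_right h'.1 hzx hz₂⟩, hz₂⟩
    rcases h2 with h2 | h2
    exacts [h2.2.subset hs, h2.2.subset (hs.trans (subset_insert _ _))]

end SeriesPairs

section Rank

/-- The rank of a matroid, as a natural number. -/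
noncomputable def rk (M : Matroid α) : ℕ := M.eRank.toNat

theorem rk_eq_ncard {M : Matroid α} {B : Set α} (hB : M.IsBase B) : rk M = B.ncard := by
  rw [rk, ← hB.encard_eq_eRank]; rfl

theorem eRank_eq_iff [Finite α] {M : Matroid α} {k : ℕ} : M.eRank = k ↔ rk M = k := by
  have h : M.eRank ≠ ⊤ :=
    ne_top_of_le_ne_top (encard_ne_top_iff.2 (toFinite M.E)) M.eRank_le_encard_ground
  rw [rk]
  constructor
  · intro h; rw [h]; simp
  · rintro rfl; exact (ENat.natCast_toNat h).symm

theorem rk_add_rk_dual [Finite α] (M : Matroid α) : rk M + rk M✶ = M.E.ncard := by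
  obtain ⟨B, hB⟩ := M.exists_isBase
  rw [rk_eq_ncard hB, rk_eq_ncard hB.compl_isBase_dual, add_comm,
    ncard_sdiff_add_ncard_of_subset hB.subset_ground (toFinite _)]

theorem rk_le_ncard [Finite α] (M : Matroid α) : rk M ≤ M.E.ncard := by
  have := rk_add_rk_dual M; omega

theorem rk_map {M : Matroid α} {σ : α → β} (hσ : InjOn σ M.E) : rk (M.map σ hσ) = rk M := by
  rw [rk, eRank_map, rk]

theorem rk_contract_add_one [Finite α] {M : Matroid α} {x : α} (hx : M.IsNonloop x) :
    rk (M.contract {x}) + 1 = rk M := by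
  obtain ⟨B, hB⟩ := (M.contract {x}).exists_isBase
  have hB' := (hx.indep.contract_isBase_iff).1 hB
  rw [rk_eq_ncard hB, rk_eq_ncard hB'.1, ncard_union_eq hB'.2 (toFinite _) (toFinite _),
    ncard_singleton]

theorem Separates.isBasis_inter {M : Matroid α} {S B : Set α} (h : Separates M S) (hS : S ⊆ M.E)
    (hB : M.IsBase B) : M.IsBasis (B ∩ S) S := by
  refine (hB.indep.subset inter_subset_left).isBasis_of_forall_insert inter_subset_right ?_
  rintro e ⟨heS, heB⟩
  have heE := hS heS
  have hE : insert e (B ∩ S) ⊆ M.E :=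
    insert_subset heE (inter_subset_left.trans hB.subset_ground)
  rw [← not_indep_iff hE]
  intro hi
  have heB' : e ∉ B := fun h => heB ⟨h, heS⟩
  have : M.Indep (insert e B) := by
    rw [h.indep_iff (insert_subset heE hB.subset_ground), insert_inter_of_mem heS,
      insert_sdiff_of_mem _ heS]
    exact ⟨hi, hB.indep.subset sdiff_subset⟩
  exact heB' (hB.eq_of_subset_indep this (subset_insert _ _) ▸ mem_insert _ _)

theorem Separates.rk_eq_add [Finite α] {M : Matroid α} {S : Set α} (h : Separates M S)
    (hS : S ⊆ M.E) : rk M = rk (M.restrict S) + rk (M.restrict (M.E \ S)) := by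
  obtain ⟨B, hB⟩ := M.exists_isBase
  rw [rk_eq_ncard hB, rk_eq_ncard (h.isBasis_inter hS hB).isBase_restrict,
    rk_eq_ncard (h.compl.isBasis_inter sdiff_subset hB).isBase_restrict, ← ncard_union_eq
    (disjoint_sdiff_right.mono inter_subset_right inter_subset_right) (toFinite _) (toFinite _),
    ← inter_union_distrib_left, union_sdiff_cancel hS, inter_eq_left.2 hB.subset_ground]

end Rank

section ParallelDecomposition

variable {M M' : Matroid α} {x : α} {S : Set α}

theorem sdiff_eq_insert_sdiff (hx : x ∈ M.E) (hxS : x ∉ S) :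
    M.E \ S = insert x ((M.contract {x}).E \ S) := by
  ext z
  by_cases hzx : z = x
  · subst hzx; simp [hx, hxS]
  · simp [hzx]

theorem indep_of_separates_of_restrict_eq (hE : M.E = M'.E) (hx : M.IsNonloop x)
    (hx' : M'.IsNonloop x) (hSE : S ⊆ (M.contract {x}).E) (hS : Separates (M.contract {x}) S)
    (hS' : Separates (M'.contract {x}) S)
    (h₁ : M.restrict (insert x S) = M'.restrict (insert x S))
    (h₂ : M.restrict (M.E \ S) = M'.restrict (M.E \ S)) {I : Set α} (hI : M.Indep I) :
    M'.Indep I := by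
  have hxE := hx.mem_ground
  have hxS : x ∉ S := fun h => (hSE h).2 rfl
  have hSE' : insert x S ⊆ M.E := insert_subset hxE (hSE.trans sdiff_subset)
  have transfer : ∀ J : Set α, J ⊆ insert x S ∨ J ⊆ M.E \ S → M.Indep J → M'.Indep J := by
    rintro J (hJ | hJ) hi
    · have : (M.restrict (insert x S)).Indep J := ⟨hi, hJ⟩
      rw [h₁] at this
      exact this.of_restrict
    · have : (M.restrict (M.E \ S)).Indep J := ⟨hi, hJ⟩
      rw [h₂] at this
      exact this.of_restrict
  have transferC : ∀ C : Set α, C ⊆ insert x S ∨ C ⊆ M.E \ S → M.IsCircuit C → M'.IsCircuit C := by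
    rintro C (hC' | hC') hC
    · have := hC.isCircuit_restrict_of_subset hC'
      rw [h₁] at this
      exact ((restrict_isCircuit_iff (hE ▸ hSE')).1 this).1
    · have := hC.isCircuit_restrict_of_subset hC'
      rw [h₂] at this
      exact ((restrict_isCircuit_iff (hE ▸ sdiff_subset)).1 this).1
  have key : ∀ J : Set α, x ∈ J → M.Indep J → M'.Indep J := by
    intro J hxJ hJ
    have hJE : J \ {x} ⊆ (M'.contract {x}).E := sdiff_subset_sdiff_left (hE ▸ hJ.subset_ground)
    have : (M'.contract {x}).Indep (J \ {x}) := by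
      rw [hS'.indep_iff hJE, hx'.contractElem_indep_iff, hx'.contractElem_indep_iff]
      refine ⟨⟨fun h => h.1.2 rfl, transfer _ (Or.inl ?_) (hJ.subset ?_)⟩,
        fun h => h.1.2 rfl, transfer _ (Or.inr ?_) (hJ.subset ?_)⟩
      · exact insert_subset_insert inter_subset_right
      · exact insert_subset hxJ (inter_subset_left.trans sdiff_subset)
      · exact insert_subset (show x ∈ M.E \ S from ⟨hxE, hxS⟩)
          fun z hz => ⟨hJ.subset_ground hz.1.1, hz.2⟩
      · exact insert_subset hxJ (sdiff_subset.trans sdiff_subset)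
    rw [hx'.contractElem_indep_iff, insert_sdiff_singleton, insert_eq_of_mem hxJ] at this
    exact this.2
  by_cases hxI : x ∈ I
  · exact key I hxI hI
  by_cases hins : M.Indep (insert x I)
  · exact (key _ (mem_insert _ _) hins).subset (subset_insert _ _)
  have hcl : x ∈ M.closure I := by
    by_contra hcl
    exact hins ((hI.insert_indep_iff_of_notMem hxI).2 ⟨hxE, hcl⟩)
  have hC := hI.fundCircuit_isCircuit hcl hxI
  have hxC := M.mem_fundCircuit x I
  have hCI := M.fundCircuit_subset_insert x I
  set C := M.fundCircuit x I with hCdef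
  obtain ⟨b, hbC, hbx⟩ : ∃ b ∈ C, b ≠ x := by
    by_contra! hno
    have : C = {x} := subset_antisymm (fun z hz => hno z hz) (singleton_subset_iff.2 hxC)
    rw [this, singleton_isCircuit] at hC
    exact hx.not_isLoop hC
  have hC' := hC.contractElem_isCircuit ⟨b, hbC, x, hxC, hbx⟩ hxC
  have hCS : C ⊆ insert x S ∨ C ⊆ M.E \ S := by
    rcases hS _ hC' with h | h
    · exact Or.inl (by rwa [sdiff_singleton_subset_iff] at h)
    · refine Or.inr fun z hz => ⟨hC.subset_ground hz, fun hzS => ?_⟩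
      exact disjoint_left.1 h ⟨hz, fun hzx => hxS (hzx ▸ hzS)⟩ hzS
  have hCM' := transferC C hCS hC
  have hins' : M.Indep (insert x I \ {b}) := by
    rw [indep_iff_forall_subset_not_isCircuit
      (sdiff_subset.trans (insert_subset hxE hI.subset_ground))]
    intro D hDs hD
    have : D = C := hD.eq_fundCircuit_of_subset hI (hDs.trans sdiff_subset)
    exact (hDs (this ▸ hbC)).2 rfl
  have hind := key (insert x I \ {b}) ⟨mem_insert _ _, fun h => hbx h.symm⟩ hins'
  rw [indep_iff_forall_subset_not_isCircuit (hE ▸ hI.subset_ground)]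
  intro D hDI hD
  have hDC : D ≠ C := fun h => hxI (hDI (h ▸ hxC))
  obtain ⟨F, hF, hFC⟩ := hD.elimination hCM' hDC b
  refine hFC.not_indep (hind.subset (hF.trans (sdiff_subset_sdiff_left ?_)))
  exact union_subset (hDI.trans (subset_insert _ _)) hCI

theorem eq_of_separates_of_restrict_eq (hE : M.E = M'.E) (hx : M.IsNonloop x)
    (hx' : M'.IsNonloop x) (hSE : S ⊆ (M.contract {x}).E) (hS : Separates (M.contract {x}) S)
    (hS' : Separates (M'.contract {x}) S)
    (h₁ : M.restrict (insert x S) = M'.restrict (insert x S))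
    (h₂ : M.restrict (M.E \ S) = M'.restrict (M.E \ S)) : M = M' := by
  refine ext_indep hE fun I _ => ⟨fun hI => ?_, fun hI => ?_⟩
  · exact indep_of_separates_of_restrict_eq hE hx hx' hSE hS hS' h₁ h₂ hI
  · refine indep_of_separates_of_restrict_eq hE.symm hx' hx ?_ hS' hS h₁.symm ?_ hI
    · rwa [contract_ground, ← hE]
    · rw [← hE]; exact h₂.symm

theorem IsSeriesParallel.restrict_insert [Finite α] (hM : IsSeriesParallel M) (hx : x ∈ M.E)
    (hSE : S ⊆ M.E) (hS : Separates (M.contract {x}) S) :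
    IsSeriesParallel (M.restrict (insert x S)) :=
  (hM.isReducible.restrict (insert_subset hx hSE)).isSeriesParallel
    (conn_restrict_insert hM.conn hx hSE hS) ⟨x, mem_insert _ _⟩

theorem IsSeriesParallel.restrict_sdiff [Finite α] (hM : IsSeriesParallel M) (hx : x ∈ M.E)
    (hxS : x ∉ S) (hS : Separates (M.contract {x}) S) :
    IsSeriesParallel (M.restrict (M.E \ S)) := by
  rw [sdiff_eq_insert_sdiff hx hxS]
  exact hM.restrict_insert hx (sdiff_subset.trans sdiff_subset) hS.compl

theorem rk_restrict_insert_add_rk_restrict_sdiff [Finite α] (hx : M.IsNonloop x)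
    (hSE : S ⊆ (M.contract {x}).E) (hS : Separates (M.contract {x}) S) :
    rk (M.restrict (insert x S)) + rk (M.restrict (M.E \ S)) = rk M + 1 := by
  have hxS : x ∉ S := fun h => (hSE h).2 rfl
  have h1 : (M.restrict (insert x S)).IsNonloop x := restrict_isNonloop_iff.2 ⟨hx, by simp⟩
  have h2 : (M.restrict (M.E \ S)).IsNonloop x :=
    restrict_isNonloop_iff.2 ⟨hx, hx.mem_ground, hxS⟩
  rw [← rk_contract_add_one hx, ← rk_contract_add_one h1, ← rk_contract_add_one h2,
    hS.rk_eq_add hSE, restrict_insert_contract hxS, sdiff_eq_insert_sdiff hx.mem_ground hxS,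
    restrict_insert_contract (fun h => h.1.2 rfl)]
  omega

theorem rk_dual_restrict_insert_add [Finite α] (hx : M.IsNonloop x)
    (hSE : S ⊆ (M.contract {x}).E) (hS : Separates (M.contract {x}) S) :
    rk (M.restrict (insert x S))✶ + rk (M.restrict (M.E \ S))✶ = rk M✶ := by
  have hxS : x ∉ S := fun h => (hSE h).2 rfl
  have h := rk_restrict_insert_add_rk_restrict_sdiff hx hSE hS
  have h1 := rk_add_rk_dual (M.restrict (insert x S))
  have h2 := rk_add_rk_dual (M.restrict (M.E \ S))
  have h3 := rk_add_rk_dual M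
  have hSM : S ⊆ M.E := hSE.trans sdiff_subset
  have h4 := ncard_sdiff_add_ncard_of_subset hSM (toFinite M.E)
  rw [restrict_ground_eq] at h1 h2
  rw [ncard_insert_of_notMem hxS (toFinite S)] at h1
  omega

end ParallelDecomposition

section DirectSum

theorem Separates.eq_of_restrict_eq {M M' : Matroid α} {S : Set α} (hE : M.E = M'.E)
    (hS : Separates M S) (hS' : Separates M' S) (h₁ : M.restrict S = M'.restrict S)
    (h₂ : M.restrict (M.E \ S) = M'.restrict (M.E \ S)) : M = M' := by
  refine ext_indep hE fun I hI => ?_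
  have e1 : ∀ J ⊆ S, (M.Indep J ↔ M'.Indep J) := fun J hJ => by
    have := congrArg (fun N => Matroid.Indep N J) h₁
    simpa [hJ] using this
  have e2 : ∀ J ⊆ M.E \ S, (M.Indep J ↔ M'.Indep J) := fun J hJ => by
    have := congrArg (fun N => Matroid.Indep N J) h₂
    simpa only [restrict_indep_iff, hJ, and_true, eq_iff_iff] using this
  rw [hS.indep_iff hI, hS'.indep_iff (hE ▸ hI), e1 _ inter_subset_right,
    e2 _ (sdiff_subset_sdiff_left hI)]

theorem component_restrict_of_separates {M : Matroid α} {S : Set α} (hS : S ⊆ M.E)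
    (h : Separates M S) {f : α} (hf : f ∈ S) : component (M.restrict S) f = component M f := by
  ext g
  constructor
  · rintro ⟨hg, hl⟩
    exact ⟨hS hg, Linked.of_restrict hS hl⟩
  · rintro ⟨hg, rfl | ⟨C, hC, hfC, hgC⟩⟩
    · exact mem_component_self (M := M.restrict S) hf
    · have hCS := (h C hC).resolve_right (not_disjoint_iff.2 ⟨f, hfC, hf⟩)
      exact ⟨hCS hgC, Or.inr ⟨C, hC.isCircuit_restrict_of_subset hCS, hfC, hgC⟩⟩

theorem component_eq_of_mem [Finite α] {M : Matroid α} {e f : α} (h : f ∈ component M e) :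
    component M f = component M e := by
  ext g
  constructor
  · rintro ⟨hg, hl⟩
    exact ⟨hg, Linked.trans h.2 hl⟩
  · rintro ⟨hg, hl⟩
    exact ⟨hg, (Linked.symm h.2).trans hl⟩

theorem isComponent_iff_of_mem [Finite α] {M : Matroid α} {e : α} (he : e ∈ M.E) {L : Set α} :
    IsComponent M L ↔ L = component M e ∨
      IsComponent (M.restrict (M.E \ component M e)) L := by
  have hsep := (separates_component M e).compl
  constructor
  · rintro ⟨f, hf, rfl⟩
    by_cases hfe : f ∈ component M e
    · exact Or.inl (component_eq_of_mem hfe)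
    · exact Or.inr ⟨f, ⟨hf, hfe⟩,
        (component_restrict_of_separates sdiff_subset hsep ⟨hf, hfe⟩).symm⟩
  · rintro (rfl | ⟨f, hf, rfl⟩)
    · exact ⟨e, he, rfl⟩
    · exact ⟨f, hf.1, component_restrict_of_separates sdiff_subset hsep hf⟩

theorem IsComponent.subset_ground {M : Matroid α} {L : Set α} (h : IsComponent M L) : L ⊆ M.E := by
  obtain ⟨e, -, rfl⟩ := h
  exact component_subset_ground M e

/-- The number of connected components. -/
noncomputable def numComponents (M : Matroid α) : ℕ := {L | IsComponent M L}.ncard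

theorem numComponents_eq_add_one [Finite α] {M : Matroid α} {e : α} (he : e ∈ M.E) :
    numComponents M = numComponents (M.restrict (M.E \ component M e)) + 1 := by
  have : {L | IsComponent M L} =
      insert (component M e) {L | IsComponent (M.restrict (M.E \ component M e)) L} := by
    ext L; exact isComponent_iff_of_mem he
  rw [numComponents, this, ncard_insert_of_notMem _ (toFinite _), numComponents]
  intro h
  exact (IsComponent.subset_ground h (mem_component_self he)).2 (mem_component_self he)

theorem isQuasiSeriesParallel_iff_of_mem [Finite α] {M : Matroid α} {e : α} (he : e ∈ M.E) :
    IsQuasiSeriesParallel M ↔ IsSeriesParallel (M.restrict (component M e)) ∧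
      IsQuasiSeriesParallel (M.restrict (M.E \ component M e)) := by
  have hr : ∀ L, IsComponent (M.restrict (M.E \ component M e)) L →
      (M.restrict (M.E \ component M e)).restrict L = M.restrict L := fun L hL =>
    restrict_restrict_eq _ hL.subset_ground
  constructor
  · intro h
    refine ⟨h _ ⟨e, he, rfl⟩, fun L hL => ?_⟩
    rw [hr L hL]
    exact h L ((isComponent_iff_of_mem he).2 (Or.inr hL))
  · rintro ⟨h1, h2⟩ L hL
    rcases (isComponent_iff_of_mem he).1 hL with rfl | hL
    · exact h1
    · rw [← hr L hL]
      exact h2 L hL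

theorem disjointSum_restrict_left {N₁ N₂ : Matroid α} (h : Disjoint N₁.E N₂.E) :
    (N₁.disjointSum N₂ h).restrict N₁.E = N₁ := by
  refine ext_indep rfl fun I (hI : I ⊆ N₁.E) => ?_
  have : I ∩ N₂.E = ∅ := (h.mono_left hI).inter_eq
  simp [this, inter_eq_left.2 hI, hI, hI.trans subset_union_left]

theorem disjointSum_restrict_right {N₁ N₂ : Matroid α} (h : Disjoint N₁.E N₂.E) :
    (N₁.disjointSum N₂ h).restrict N₂.E = N₂ := by
  rw [disjointSum_comm]
  exact disjointSum_restrict_left h.symm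

theorem separates_disjointSum {N₁ N₂ : Matroid α} (h : Disjoint N₁.E N₂.E) :
    Separates (N₁.disjointSum N₂ h) N₁.E := by
  refine separates_of_indep fun I hI h1 h2 => ?_
  rw [disjointSum_indep_iff] at h1 h2 ⊢
  have : I \ N₁.E ∩ N₂.E = I ∩ N₂.E := by
    ext z
    exact ⟨fun hz => ⟨hz.1.1, hz.2⟩, fun hz => ⟨⟨hz.1, fun h' => disjoint_left.1 h h' hz.2⟩, hz.2⟩⟩
  rw [this] at h2
  rw [inter_assoc, inter_self] at h1
  exact ⟨h1.1, h2.2.1, by simpa using hI⟩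

end DirectSum

section Injective

variable {M : Matroid α} {σ : α → β}

theorem map_isCircuit_iff (hσ : InjOn σ M.E) {C : Set β} :
    (M.map σ hσ).IsCircuit C ↔ ∃ D, M.IsCircuit D ∧ σ '' D = C := by
  refine ⟨fun hC => ?_, fun ⟨D, hD, h⟩ => h ▸ map_isCircuit hσ hD⟩
  obtain ⟨D, hD, rfl⟩ := map_dep_iff.1 hC.dep
  obtain ⟨F, hFD, hF⟩ := hD.exists_isCircuit_subset
  exact ⟨F, hF, (map_isCircuit hσ hF).eq_of_subset_isCircuit hC (image_mono hFD)⟩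

theorem linked_map_iff (hσ : σ.Injective) {e f : α} :
    Linked (M.map σ hσ.injOn) (σ e) (σ f) ↔ Linked M e f := by
  simp only [Linked, hσ.eq_iff, map_isCircuit_iff]
  refine or_congr Iff.rfl ⟨?_, ?_⟩
  · rintro ⟨_, ⟨D, hD, rfl⟩, he, hf⟩
    exact ⟨D, hD, hσ.mem_set_image.1 he, hσ.mem_set_image.1 hf⟩
  · rintro ⟨D, hD, he, hf⟩
    exact ⟨_, ⟨D, hD, rfl⟩, mem_image_of_mem _ he, mem_image_of_mem _ hf⟩

theorem conn_map_iff (hσ : σ.Injective) : Conn (M.map σ hσ.injOn) ↔ Conn M := by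
  simp only [Conn, map_ground, forall_mem_image, linked_map_iff hσ]

theorem component_map (hσ : σ.Injective) (e : α) :
    component (M.map σ hσ.injOn) (σ e) = σ '' component M e := by
  ext g
  constructor
  · rintro ⟨⟨f, hf, rfl⟩, hl⟩
    exact ⟨f, ⟨hf, (linked_map_iff hσ).1 hl⟩, rfl⟩
  · rintro ⟨f, ⟨hf, hl⟩, rfl⟩
    exact ⟨⟨f, hf, rfl⟩, (linked_map_iff hσ).2 hl⟩

theorem isComponent_map_iff (hσ : σ.Injective) {L : Set β} :
    IsComponent (M.map σ hσ.injOn) L ↔ ∃ K, IsComponent M K ∧ σ '' K = L := by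
  constructor
  · rintro ⟨_, ⟨e, he, rfl⟩, rfl⟩
    exact ⟨_, ⟨e, he, rfl⟩, (component_map hσ e).symm⟩
  · rintro ⟨_, ⟨e, he, rfl⟩, rfl⟩
    exact ⟨σ e, ⟨e, he, rfl⟩, (component_map hσ e).symm⟩

theorem numComponents_map (hσ : σ.Injective) :
    numComponents (M.map σ hσ.injOn) = numComponents M := by
  rw [numComponents, numComponents, ← ncard_image_of_injective _ (image_injective.2 hσ)]
  congr 1
  ext L
  exact isComponent_map_iff hσ

theorem map_restrict (hσ : σ.Injective) (R : Set α) :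
    (M.map σ hσ.injOn).restrict (σ '' R) = (M.restrict R).map σ hσ.injOn := by
  refine ext_indep rfl fun I _ => ?_
  simp only [restrict_indep_iff, map_indep_iff]
  constructor
  · rintro ⟨⟨J, hJ, rfl⟩, hR⟩
    exact ⟨J, ⟨hJ, (image_subset_image_iff hσ).1 hR⟩, rfl⟩
  · rintro ⟨J, ⟨hJ, hR⟩, rfl⟩
    exact ⟨⟨J, hJ, rfl⟩, image_mono hR⟩

theorem isQuasiSeriesParallel_map_iff (hσ : σ.Injective) :
    IsQuasiSeriesParallel (M.map σ hσ.injOn) ↔ IsQuasiSeriesParallel M := by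
  constructor
  · intro h K hK
    have := h _ ((isComponent_map_iff hσ).2 ⟨K, hK, rfl⟩)
    rwa [map_restrict hσ, isSeriesParallel_map_iff hσ] at this
  · intro h L hL
    obtain ⟨K, hK, rfl⟩ := (isComponent_map_iff hσ).1 hL
    rw [map_restrict hσ, isSeriesParallel_map_iff hσ]
    exact h K hK

end Injective

section WeightedSums

instance [Finite α] : Finite (Matroid α) :=
  Finite.of_injective (fun M : Matroid α => (M.E, {I | M.Indep I})) fun M N h => by
    simp only [Prod.mk.injEq] at h
    exact ext_indep h.1 fun I _ => by
      have := congrArg (I ∈ ·) h.2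
      simpa using this

/-- The finite set of matroids on a finite type that satisfy `p`. -/
noncomputable def collect [Finite α] (p : Matroid α → Prop) : Finset (Matroid α) :=
  (toFinite {M | p M}).toFinset

@[simp] theorem mem_collect [Finite α] {p : Matroid α → Prop} {M : Matroid α} :
    M ∈ collect p ↔ p M := by simp [collect]

variable {R : Type w} [CommRing R]

theorem sum_collect_range [Finite α] [Finite β] (f : β ↪ α) {p : Matroid β → Prop}
    {q : Matroid α → Prop} {wβ : Matroid β → R} {wα : Matroid α → R}
    (hpq : ∀ N : Matroid β, N.E = univ → (q (N.map f f.injective.injOn) ↔ p N))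
    (hw : ∀ N : Matroid β, wα (N.map f f.injective.injOn) = wβ N) {K : Finset α}
    (hK : range f = K) :
    ∑ M ∈ collect (fun M => M.E = (K : Set α) ∧ q M), wα M =
      ∑ N ∈ collect (fun N => N.E = univ ∧ p N), wβ N := by
  symm
  refine Finset.sum_bij (fun N _ => N.map f f.injective.injOn) ?_ ?_ ?_ ?_
  · intro N hN
    rw [mem_collect] at hN ⊢
    exact ⟨by rw [map_ground, hN.1, image_univ, hK], (hpq N hN.1).2 hN.2⟩
  · intro N _ N' _ h
    rw [← comap_map (M := N) f.injective, ← comap_map (M := N') f.injective, h]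
  · intro M hM
    rw [mem_collect] at hM
    have h := map_comap (N := M) (f := f) (by rw [hM.1, hK]) f.injective.injOn
    refine ⟨M.comap f, ?_, h⟩
    rw [mem_collect]
    have hE : (M.comap f).E = univ := by rw [comap_ground_eq, hM.1, ← hK, preimage_range]
    refine ⟨hE, ?_⟩
    rw [← hpq _ hE, h]
    exact hM.2
  · intro N _
    exact (hw N).symm

theorem exists_embedding_range (K : Finset α) {n : ℕ} (hn : K.card = n) :
    ∃ f : Fin n ↪ α, range f = K := by
  subst hn
  refine ⟨K.equivFin.symm.toEmbedding.trans (Function.Embedding.subtype _), ?_⟩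
  ext z
  simp only [Function.Embedding.trans_apply, mem_range, Function.Embedding.subtype_apply,
    Equiv.coe_toEmbedding, Finset.mem_coe]
  exact ⟨fun ⟨i, hi⟩ => hi ▸ (K.equivFin.symm i).2, fun hz => ⟨K.equivFin ⟨z, hz⟩, by simp⟩⟩

theorem exists_embedding_range_zero {K : Finset α} {x : α} (hx : x ∈ K) {n : ℕ}
    (hn : K.card = n + 1) : ∃ f : Fin (n + 1) ↪ α, range f = K ∧ f 0 = x := by
  obtain ⟨f, hf⟩ := exists_embedding_range K hn
  obtain ⟨i, rfl⟩ : x ∈ range f := hf ▸ hx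
  refine ⟨(Equiv.swap 0 i).toEmbedding.trans f, ?_, by simp⟩
  rw [Function.Embedding.coe_trans, Equiv.coe_toEmbedding, (Equiv.surjective _).range_comp, hf]

/-- The weight `a ^ rank * b ^ corank`. -/
noncomputable def weight (a b : R) (M : Matroid α) : R := a ^ rk M * b ^ rk M✶

theorem weight_map (a b : R) {M : Matroid α} {σ : α → β} (hσ : InjOn σ M.E) :
    weight a b (M.map σ hσ) = weight a b M := by
  rw [weight, weight, map_dual, rk_map hσ, rk_map (M := M✶) hσ]

theorem weight_dual (a b : R) (M : Matroid α) : weight a b M✶ = weight b a M := by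
  rw [weight, weight, dual_dual, mul_comm]

/-- The weighted number of series-parallel matroids on `K`. -/
noncomputable def spSum [Finite α] (a b : R) (K : Finset α) : R :=
  ∑ M ∈ collect (fun M => M.E = (K : Set α) ∧ IsSeriesParallel M), weight a b M

/-- The weighted number of series-parallel matroids on `K` whose contraction by `x` is
disconnected. -/
noncomputable def parSum [Finite α] (a b : R) (x : α) (K : Finset α) : R :=
  ∑ M ∈ collect (fun M => M.E = (K : Set α) ∧ IsSeriesParallel M ∧ ¬ Conn (M.contract {x})), weight a b M

/-- The weighted number of series-parallel matroids on `K` whose contraction by `x` is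
connected. -/
noncomputable def conSum [Finite α] (a b : R) (x : α) (K : Finset α) : R :=
  ∑ M ∈ collect (fun M => M.E = (K : Set α) ∧ IsSeriesParallel M ∧ Conn (M.contract {x})), weight a b M

/-- The weighted number of quasi series-parallel matroids on `K`. -/
noncomputable def qspSum [Finite α] (a z : R) (K : Finset α) : R :=
  ∑ M ∈ collect (fun M => M.E = (K : Set α) ∧ IsQuasiSeriesParallel M), a ^ rk M * z ^ numComponents M

theorem spSum_eq_add [Finite α] (a b : R) (x : α) (K : Finset α) :
    spSum a b K = parSum a b x K + conSum a b x K := by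
  classical
  rw [spSum, parSum, conSum, ← Finset.sum_filter_not_add_sum_filter _
    (fun M : Matroid α => Conn (M.contract {x}))]
  congr 1 <;> refine Finset.sum_congr (by ext M; simp [and_assoc]) fun _ _ => rfl

noncomputable def spCount (a b : R) (n : ℕ) : R := spSum a b (Finset.univ : Finset (Fin n))

noncomputable def parCount (a b : R) (n : ℕ) : R :=
  parSum a b 0 (Finset.univ : Finset (Fin (n + 1)))

noncomputable def qspCount (a z : R) (n : ℕ) : R := qspSum a z (Finset.univ : Finset (Fin n))

theorem spSum_eq_spCount [Finite α] (a b : R) (K : Finset α) :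
    spSum a b K = spCount a b K.card := by
  obtain ⟨f, hf⟩ := exists_embedding_range K rfl
  rw [spCount, spSum, spSum, Finset.coe_univ]
  exact sum_collect_range f (fun N _ => isSeriesParallel_map_iff f.injective)
    (fun N => weight_map a b _) hf

theorem qspSum_eq_qspCount [Finite α] (a z : R) (K : Finset α) :
    qspSum a z K = qspCount a z K.card := by
  obtain ⟨f, hf⟩ := exists_embedding_range K rfl
  rw [qspCount, qspSum, qspSum, Finset.coe_univ]
  exact sum_collect_range f (fun N _ => isQuasiSeriesParallel_map_iff f.injective)
    (fun N => by rw [rk_map, numComponents_map f.injective]) hf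

theorem parSum_eq_parCount [Finite α] (a b : R) {x : α} {K : Finset α} (hx : x ∈ K) {n : ℕ}
    (hn : K.card = n + 1) : parSum a b x K = parCount a b n := by
  obtain ⟨f, hf, rfl⟩ := exists_embedding_range_zero hx hn
  rw [parCount, parSum, parSum, Finset.coe_univ]
  refine sum_collect_range f (fun N hN => ?_) (fun N => weight_map a b _) hf
  rw [isSeriesParallel_map_iff f.injective, map_contract_singleton (by simp [hN]),
    conn_map_iff f.injective]

end WeightedSums

section Recursions

variable {R : Type w} [CommRing R]

theorem weight_mul_weight_restrict [Finite α] (a b : R) {M : Matroid α} {x : α} {S : Set α}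
    (hx : M.IsNonloop x) (hSE : S ⊆ (M.contract {x}).E) (hS : Separates (M.contract {x}) S) :
    a * weight a b M = weight a b (M.restrict (insert x S)) * weight a b (M.restrict (M.E \ S)) := by
  rw [weight, weight, weight, ← rk_dual_restrict_insert_add hx hSE hS, pow_add, ← mul_assoc,
    ← pow_succ', ← rk_restrict_insert_add_rk_restrict_sdiff hx hSE hS, pow_add]
  ring

theorem sum_component_contract_eq [Fintype α] [DecidableEq α] (a b : R) {x e : α} {A : Finset α}
    (he : e ∈ A) (hx : x ∉ A) (hA : insert x A ≠ Finset.univ) :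
    a * ∑ M ∈ collect (fun M : Matroid α => M.E = (Finset.univ : Finset α) ∧ IsSeriesParallel M ∧
        component (M.contract {x}) e = A), weight a b M =
      conSum a b x (insert x A) * spSum a b (Finset.univ \ A) := by
  have hex : e ≠ x := fun h => hx (h ▸ he)
  obtain ⟨y, hyx, hyA⟩ : ∃ y, y ≠ x ∧ y ∉ A := by
    by_contra! hno
    refine hA (Finset.eq_univ_iff_forall.2 fun z => ?_)
    by_cases hz : z = x
    · simp [hz]
    · simp [hno z hz]
  have hAx : (A : Set α) ⊆ univ \ {x} := fun z hz => ⟨mem_univ _, fun h => hx (h ▸ hz)⟩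
  rw [conSum, spSum, Finset.sum_mul_sum, ← Finset.sum_product', Finset.mul_sum]
  simp only [Finset.coe_univ, Finset.coe_insert, Finset.coe_sdiff]
  have facts : ∀ M : Matroid α, M.E = univ ∧ IsSeriesParallel M ∧
      component (M.contract {x}) e = A → M.IsNonloop x ∧ (A : Set α) ⊆ (M.contract {x}).E ∧
        Separates (M.contract {x}) A := by
    rintro M ⟨hE, hM, hc⟩
    refine ⟨hM.conn.isNonloop (by simp [hE]) (by simp [hE]) hex.symm, ?_, ?_⟩
    · rwa [contract_ground, hE]
    · rw [← hc]; exact separates_component _ _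
  refine Finset.sum_bij (fun M _ => (M.restrict (insert x (A : Set α)), M.restrict (univ \ A)))
    ?_ ?_ ?_ ?_
  · intro M hM
    rw [mem_collect] at hM
    obtain ⟨hxM, hAE, hS⟩ := facts M hM
    obtain ⟨hE, hM, hc⟩ := hM
    rw [Finset.mem_product, mem_collect, mem_collect]
    refine ⟨⟨rfl, hM.restrict_insert hxM.mem_ground (hAE.trans sdiff_subset) hS, ?_⟩, rfl, ?_⟩
    · rw [restrict_insert_contract (by simpa using hx), ← hc]
      exact conn_restrict_component (hAE he)
    · rw [← hE]
      exact hM.restrict_sdiff hxM.mem_ground hx hS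
  · intro M hM M' hM' h
    rw [mem_collect] at hM hM'
    obtain ⟨hxM, hAE, hS⟩ := facts M hM
    obtain ⟨hxM', -, hS'⟩ := facts M' hM'
    rw [Prod.mk.injEq] at h
    exact eq_of_separates_of_restrict_eq (hM.1.trans hM'.1.symm) hxM hxM' hAE hS hS' h.1
      (by rw [hM.1]; exact h.2)
  · rintro ⟨N₁, N₂⟩ hN
    rw [Finset.mem_product, mem_collect, mem_collect] at hN
    obtain ⟨⟨hE₁, hN₁, hc₁⟩, hE₂, hN₂⟩ := hN
    dsimp only at hE₁ hN₁ hc₁ hE₂ hN₂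
    have h₁ : N₁.IsNonloop x := hN₁.conn.isNonloop (by simp [hE₁]) (y := e)
      (by rw [hE₁]; exact Or.inr he) hex.symm
    have h₂ : N₂.IsNonloop x := hN₂.conn.isNonloop (by simp [hE₂, hx]) (y := y)
      (by simp [hE₂, hyA]) hyx.symm
    obtain ⟨P, hP⟩ := exists_isParConn (x := x) (N₁ := N₁) (N₂ := N₂) (by
      rw [hE₁, hE₂]
      ext z
      by_cases hzx : z = x
      · subst hzx; simp [hx]
      · simp [hzx]) h₁ h₂
    have hPE : P.E = univ := by
      rw [hP.ground_eq, hE₁, hE₂]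
      refine eq_univ_of_forall fun z => ?_
      by_cases hz : z ∈ A
      · exact Or.inl (Or.inr hz)
      · exact Or.inr ⟨mem_univ _, hz⟩
    have h2 : 2 ≤ N₁.E.ncard := by
      have h' := ncard_le_ncard (show ({e, x} : Set α) ⊆ N₁.E by
        rw [hE₁]; exact insert_subset (Or.inr he) (singleton_subset_iff.2 (Or.inl rfl)))
      rwa [ncard_pair hex] at h'
    have hr₁ : P.restrict (insert x (A : Set α)) = N₁ := by rw [← hE₁]; exact hP.restrict_left
    have hr₂ : P.restrict (univ \ A) = N₂ := by rw [← hE₂]; exact hP.restrict_right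
    have hAE : N₁.E \ {x} = A := by
      rw [hE₁, insert_sdiff_of_mem _ (mem_singleton x), sdiff_singleton_eq_self (by simpa using hx)]
    refine ⟨P, ?_, by rw [hr₁, hr₂]⟩
    rw [mem_collect]
    refine ⟨hPE, hP.isSeriesParallel hN₁ h2 hN₂, component_eq_of_separates ?_ he ?_ ?_⟩
    · rwa [contract_ground, hPE]
    · rw [← hAE]; exact hP.separates_contract
    · rw [← restrict_insert_contract (by simpa using hx), hr₁]
      exact hc₁
  · intro M hM
    rw [mem_collect] at hM
    obtain ⟨hxM, hAE, hS⟩ := facts M hM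
    rw [weight_mul_weight_restrict a b hxM hAE hS, hM.1]

theorem parSum_univ_eq [Fintype α] [DecidableEq α] (a b : R) {x e : α} (hex : e ≠ x) :
    a * parSum a b x Finset.univ = ∑ S ∈ (Finset.univ \ {x, e} : Finset α).powerset,
      if S = Finset.univ \ {x, e} then 0 else
        conSum a b x (insert x (insert e S)) * spSum a b (Finset.univ \ insert e S) := by
  classical
  rw [parSum, ← Finset.sum_fiberwise_of_maps_to (t := (Finset.univ \ {x, e} : Finset α).powerset)
    (g := fun M => (toFinite (component (M.contract {x}) e)).toFinset.erase e), Finset.mul_sum]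
  · refine Finset.sum_congr rfl fun S hS => ?_
    rw [Finset.mem_powerset] at hS
    have heS : e ∉ S := fun h => by simpa using hS h
    have hxS : x ∉ S := fun h => by simpa using hS h
    have hfib : ∀ M : Matroid α, M.E = (Finset.univ : Finset α) →
        ((toFinite (component (M.contract {x}) e)).toFinset.erase e = S ↔
          component (M.contract {x}) e = ((insert e S : Finset α) : Set α)) := by
      intro M hE
      have hmem : e ∈ (toFinite (component (M.contract {x}) e)).toFinset := by
        rw [Finite.mem_toFinset]
        exact mem_component_self ⟨by simp [hE], hex⟩
      constructor
      · intro h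
        rw [← h, Finset.insert_erase hmem, Finite.coe_toFinset]
      · intro h
        rw [← Finset.erase_insert heS]
        congr 1
        exact Finset.coe_injective (by rw [Finite.coe_toFinset, h])
    split_ifs with hfull
    · rw [Finset.sum_eq_zero, mul_zero]
      intro M hM
      rw [Finset.mem_filter, mem_collect] at hM
      obtain ⟨⟨hE, hM, hnc⟩, hS⟩ := hM
      exfalso
      apply hnc
      rw [hfib M hE] at hS
      have hE' : (M.contract {x}).E ⊆ component (M.contract {x}) e := by
        rw [hS, hfull]
        intro z hz
        have : z ≠ x := hz.2
        by_cases hze : z = e <;> simp [hze, this]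
      exact conn_of_forall_linked (x := e) fun z hz => (hE' hz).2
    · rw [← sum_component_contract_eq a b (Finset.mem_insert_self e S)
        (by simp [hxS, hex.symm])]
      · congr 1
        refine Finset.sum_congr ?_ fun _ _ => rfl
        ext M
        rw [Finset.mem_filter, mem_collect, mem_collect]
        constructor
        · rintro ⟨⟨hE, hM, -⟩, hc⟩
          exact ⟨hE, hM, (hfib M hE).1 hc⟩
        · rintro ⟨hE, hM, hc⟩
          refine ⟨⟨hE, hM, fun hconn => hfull ?_⟩, (hfib M hE).2 hc⟩
          have := hconn.component_eq (e := e) ⟨by simp [hE], hex⟩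
          rw [hc, contract_ground, hE] at this
          ext z
          have hz := Set.ext_iff.1 this z
          by_cases hze : z = e
          · simp [hze, heS]
          · simpa [hze] using hz
      · intro hu
        refine hfull (subset_antisymm hS fun z hz => ?_)
        have : z ∈ insert x (insert e S) := hu ▸ Finset.mem_univ z
        simp only [Finset.mem_sdiff, Finset.mem_univ, Finset.mem_insert, Finset.mem_singleton,
          true_and] at hz this
        tauto
  · intro M _
    rw [Finset.mem_powerset]
    intro z hz
    rw [Finset.mem_erase, Finite.mem_toFinset] at hz
    have : z ≠ x := (component_subset_ground _ _ hz.2).2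
    simp [hz.1, this]

/-- The weighted number of series-parallel matroids on `n + 1` elements for `n ≥ 1`. -/
noncomputable def rootedCount (a b : R) (n : ℕ) : R := if n = 0 then 0 else spCount a b (n + 1)

theorem mul_parCount_succ (a b : R) (n : ℕ) :
    a * parCount a b (n + 1) = ∑ j ∈ Finset.range (n + 1), n.choose j •
      ((rootedCount a b (j + 1) - parCount a b (j + 1)) * rootedCount a b (n - j)) := by
  rw [parCount, parSum_univ_eq a b (e := (1 : Fin (n + 2))) (by simp)]
  have hcard : (Finset.univ \ {0, 1} : Finset (Fin (n + 2))).card = n := by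
    rw [Finset.card_sdiff_of_subset (Finset.subset_univ _), Finset.card_pair (by simp)]
    simp
  rw [← congrArg (fun m => ∑ j ∈ Finset.range (m + 1), m.choose j •
      ((rootedCount a b (j + 1) - parCount a b (j + 1)) * rootedCount a b (n - j))) hcard,
    ← Finset.sum_powerset_apply_card (fun j =>
      (rootedCount a b (j + 1) - parCount a b (j + 1)) * rootedCount a b (n - j))]
  refine Finset.sum_congr rfl fun S hS => ?_
  rw [Finset.mem_powerset] at hS
  have h1 : (1 : Fin (n + 2)) ∉ S := fun h => by simpa using hS h
  have h0 : (0 : Fin (n + 2)) ∉ S := fun h => by simpa using hS h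
  have hle := Finset.card_le_card hS
  rw [hcard] at hle
  split_ifs with hfull
  · rw [hfull, hcard, Nat.sub_self]
    simp [rootedCount]
  have hlt : S.card < n := by
    refine lt_of_le_of_ne hle fun h => hfull (Finset.eq_of_subset_of_card_le hS ?_)
    rw [hcard, h]
  have hc1 : (insert 1 S).card = S.card + 1 := Finset.card_insert_of_notMem h1
  have hc0 : (insert 0 (insert 1 S)).card = S.card + 1 + 1 := by
    rw [Finset.card_insert_of_notMem (by simp [h0]), hc1]
  have hcon := spSum_eq_add a b 0 (insert 0 (insert 1 S))
  rw [spSum_eq_spCount, hc0, parSum_eq_parCount a b (by simp) hc0] at hcon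
  have hcc : (Finset.univ \ insert 1 S).card = n - S.card + 1 := by
    rw [Finset.card_sdiff_of_subset (Finset.subset_univ _), hc1, Finset.card_univ, Fintype.card_fin]
    omega
  rw [spSum_eq_spCount, hcc, rootedCount, rootedCount, if_neg (by omega), if_neg (by omega), hcon]
  ring

end Recursions

section SmallCounts

variable {R : Type w} [CommRing R]

theorem conn_of_subsingleton {M : Matroid α} (h : M.E.Subsingleton) : Conn M :=
  fun _ he _ hf => Or.inl (h hf he)

theorem rootedCount_eq_parCount_add (a b : R) {n : ℕ} (hn : 2 ≤ n) :
    rootedCount a b n = parCount a b n + parCount b a n := by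
  rw [rootedCount, if_neg (by omega), spCount, spSum_eq_add a b 0, parCount, parCount]
  congr 1
  rw [conSum, parSum]
  have key : ∀ M : Matroid (Fin (n + 1)), M.E = univ → IsSeriesParallel M →
      (Conn (M✶.contract {0}) ↔ ¬ Conn (M.contract {0})) := by
    intro M hE hM
    rw [← dual_delete, (hM.isReducible.delete_contract 0).1.conn_dual_iff,
      hM.conn_contract_iff_not_conn_delete (by simp [hE]) (by simp [hE, ncard_univ]; omega),
      not_not]
  refine Finset.sum_bij' (fun M _ => M✶) (fun M _ => M✶) ?_ ?_ (fun M _ => dual_dual M)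
    (fun M _ => dual_dual M) (fun M _ => (weight_dual b a M).symm)
  · intro M hM
    simp only [mem_collect, Finset.coe_univ, dual_ground] at hM ⊢
    exact ⟨hM.1, hM.2.1.dual, fun h => (key M hM.1 hM.2.1).1 h hM.2.2⟩
  · intro M hM
    simp only [mem_collect, Finset.coe_univ, dual_ground] at hM ⊢
    exact ⟨hM.1, hM.2.1.dual, (key M hM.1 hM.2.1).2 hM.2.2⟩

theorem parCount_of_le_one (a b : R) {n : ℕ} (hn : n ≤ 1) : parCount a b n = 0 := by
  rw [parCount, parSum]
  refine Finset.sum_eq_zero fun M hM => ?_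
  rw [mem_collect] at hM
  refine absurd (conn_of_subsingleton ?_) hM.2.2
  intro z hz w hw
  have hz' : z ≠ 0 := hz.2
  have hw' : w ≠ 0 := hw.2
  have := z.2
  have := w.2
  ext
  have := Fin.val_ne_of_ne hz'
  have := Fin.val_ne_of_ne hw'
  simp at *
  omega

theorem eq_of_isCircuit_ground {M M' : Matroid α} (hE : M.E = M'.E) (h : M.IsCircuit M.E)
    (h' : M'.IsCircuit M'.E) : M = M' := by
  refine ext_indep hE fun I hI => ?_
  by_cases hIE : I = M.E
  · subst hIE
    rw [hE]
    rw [hE] at h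
    exact iff_of_false h.not_indep h'.not_indep
  · have hs := hI.ssubset_of_ne hIE
    exact iff_of_true (h.ssubset_indep hs) (h'.ssubset_indep (hE ▸ hs))

theorem isSeriesParallel_of_ground_eq_singleton {M : Matroid α} {e : α} (hE : M.E = {e}) :
    IsSeriesParallel M := by
  by_cases he : M.IsLoop e
  · exact isSeriesParallel_of_isLoop hE he
  · have hn : M.IsNonloop e := isNonloop_of_not_isLoop (by simp [hE]) he
    refine isSeriesParallel_dual_iff.1 (isSeriesParallel_of_isLoop (M := M✶) hE ?_)
    rw [dual_isLoop_iff_isColoop, isColoop_iff_forall_insert_indep]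
    intro I hI
    refine hn.indep.subset (insert_subset rfl (hE ▸ hI.subset_ground))

theorem exists_par_zero_one : ∃ M : Matroid (Fin 2), M.E = univ ∧ Par M 0 1 := by
  refine ⟨(freeOn {()}).comap (fun _ : Fin 2 => ()), by ext; simp, by simp, ?_⟩
  rw [isCircuit_iff_dep_forall_sdiff_singleton_indep]
  constructor
  · rw [dep_iff, comap_indep_iff]
    refine ⟨fun h => ?_, by intro; simp⟩
    exact absurd (h.2 (show (0 : Fin 2) ∈ {0, 1} by simp) (show (1 : Fin 2) ∈ {0, 1} by simp) rfl)
      (by simp)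
  · rintro e (rfl | rfl)
    · rw [pair_sdiff_left (by simp)]; simp
    · rw [pair_sdiff_right (by simp)]; simp

theorem rootedCount_one (a b : R) : rootedCount a b 1 = a * b := by
  have huniv : (univ : Set (Fin 2)) = {0, 1} := by ext i; fin_cases i <;> simp
  obtain ⟨M₀, hE₀, hp₀⟩ := exists_par_zero_one
  have hM₀ : IsSeriesParallel M₀ := by
    refine hp₀.isSeriesParallel_delete_iff.1 (isSeriesParallel_of_ground_eq_singleton (e := 1) ?_)
    rw [delete_ground, hE₀, huniv]
    exact pair_sdiff_left (by simp)
  have hcol : collect (fun M : Matroid (Fin 2) =>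
      M.E = ((Finset.univ : Finset (Fin 2)) : Set (Fin 2)) ∧ IsSeriesParallel M) = {M₀} := by
    ext M
    rw [mem_collect, Finset.mem_singleton, Finset.coe_univ]
    constructor
    · rintro ⟨hE, hM⟩
      have hp := par_of_conn_of_ground_eq_pair hM.conn (hE.trans huniv) (by simp)
      refine eq_of_isCircuit_ground (hE.trans hE₀.symm) ?_ ?_
      · rw [hE, huniv]; exact hp.2
      · rw [hE₀, huniv]; exact hp₀.2
    · rintro rfl
      exact ⟨hE₀, hM₀⟩
  have hrk : rk M₀ = 1 := by
    have h := hp₀.2.sdiff_singleton_isBasis (e := 0) (by simp)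
    rw [pair_sdiff_left (by simp), ← huniv, ← hE₀, isBasis_ground_iff] at h
    rw [rk_eq_ncard h, ncard_singleton]
  have hrk' : rk M₀✶ = 1 := by
    have := rk_add_rk_dual M₀
    rw [hE₀, ncard_univ, Nat.card_fin] at this
    omega
  rw [rootedCount, if_neg (by simp), spCount, spSum, hcol, Finset.sum_singleton, weight, hrk, hrk',
    pow_one, pow_one]

theorem spCount_one (a b : R) : spCount a b 1 = a + b := by
  classical
  have huniv : (univ : Set (Fin 1)) = {0} := by ext i; fin_cases i; simp
  have hne : (loopyOn univ : Matroid (Fin 1)) ≠ freeOn univ := by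
    intro h
    have h1 : (freeOn univ : Matroid (Fin 1)).Indep univ := by simp
    rw [← h, loopyOn_indep_iff] at h1
    exact univ_nonempty.ne_empty h1
  have hcol : collect (fun M : Matroid (Fin 1) =>
      M.E = ((Finset.univ : Finset (Fin 1)) : Set (Fin 1)) ∧ IsSeriesParallel M) =
        {freeOn univ, loopyOn univ} := by
    ext M
    rw [mem_collect, Finset.mem_insert, Finset.mem_singleton, Finset.coe_univ]
    constructor
    · rintro ⟨hE, -⟩
      by_cases h : M.IsLoop 0
      · right
        refine eq_loopyOn_iff_loops.2 ⟨?_, hE⟩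
        rw [huniv]
        exact subset_antisymm (by rw [← huniv]; exact subset_univ _) (singleton_subset_iff.2 h)
      · left
        rw [eq_freeOn_iff]
        refine ⟨hE, ?_⟩
        rw [huniv, indep_singleton]
        exact not_isLoop_iff (by simp [hE]) |>.1 h
    · rintro (rfl | rfl)
      · exact ⟨rfl, isSeriesParallel_of_ground_eq_singleton huniv⟩
      · exact ⟨rfl, isSeriesParallel_of_ground_eq_singleton huniv⟩
  rw [spCount, spSum, hcol, Finset.sum_pair hne.symm]
  simp [weight, rk, eRank_freeOn]

end SmallCounts

section QuasiSeriesParallel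

variable {R : Type w} [CommRing R]

theorem qspSum_univ_eq [Fintype α] [DecidableEq α] (a z : R) (x : α) :
    qspSum a z (Finset.univ : Finset α) = ∑ S ∈ (Finset.univ \ {x} : Finset α).powerset,
      z * spSum a 1 (insert x S) * qspSum a z (Finset.univ \ insert x S : Finset α) := by
  classical
  rw [qspSum, ← Finset.sum_fiberwise_of_maps_to (t := (Finset.univ \ {x} : Finset α).powerset)
    (g := fun M => (toFinite (component M x)).toFinset.erase x)]
  · refine Finset.sum_congr rfl fun S hS => ?_
    rw [Finset.mem_powerset] at hS
    have hxS : x ∉ S := fun h => by simpa using hS h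
    have hfib : ∀ M : Matroid α, M.E = univ →
        ((toFinite (component M x)).toFinset.erase x = S ↔
          component M x = insert x (S : Set α)) := by
      intro M hE
      have hmem : x ∈ (toFinite (component M x)).toFinset := by
        rw [Finite.mem_toFinset]
        exact mem_component_self (by simp [hE])
      constructor
      · intro h
        rw [← h, ← Finset.coe_insert, Finset.insert_erase hmem, Finite.coe_toFinset]
      · intro h
        rw [← Finset.erase_insert hxS]
        congr 1
        exact Finset.coe_injective (by rw [Finite.coe_toFinset, h, Finset.coe_insert])
    rw [spSum, qspSum, mul_assoc, Finset.sum_mul_sum, ← Finset.sum_product', Finset.mul_sum]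
    simp only [Finset.coe_univ, Finset.coe_insert, Finset.coe_sdiff]
    refine Finset.sum_bij
      (fun M _ => (M.restrict (insert x (S : Set α)), M.restrict (univ \ insert x (S : Set α))))
      ?_ ?_ ?_ ?_
    · intro M hM
      rw [Finset.mem_filter, mem_collect] at hM
      obtain ⟨⟨hE, hM⟩, hc⟩ := hM
      rw [hfib M hE] at hc
      rw [isQuasiSeriesParallel_iff_of_mem (e := x) (by simp [hE]), hc, hE] at hM
      rw [Finset.mem_product, mem_collect, mem_collect]
      exact ⟨⟨rfl, hM.1⟩, rfl, hM.2⟩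
    · intro M hM M' hM' h
      rw [Finset.mem_filter, mem_collect] at hM hM'
      have hc := (hfib M hM.1.1).1 hM.2
      have hc' := (hfib M' hM'.1.1).1 hM'.2
      rw [Prod.mk.injEq] at h
      refine Separates.eq_of_restrict_eq (S := insert x (S : Set α)) (hM.1.1.trans hM'.1.1.symm)
        (hc ▸ separates_component M x) (hc' ▸ separates_component M' x) h.1
        (by rw [hM.1.1]; exact h.2)
    · rintro ⟨N₁, N₂⟩ hN
      rw [Finset.mem_product, mem_collect, mem_collect] at hN
      obtain ⟨⟨hE₁, hN₁⟩, hE₂, hN₂⟩ := hN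
      dsimp only at hE₁ hN₁ hE₂ hN₂
      have hd : Disjoint N₁.E N₂.E := by rw [hE₁, hE₂]; exact disjoint_sdiff_right
      have hE : (N₁.disjointSum N₂ hd).E = univ := by
        rw [disjointSum_ground_eq, hE₁, hE₂, union_sdiff_cancel (subset_univ _)]
      have hr₁ := disjointSum_restrict_left hd
      have hr₂ := disjointSum_restrict_right hd
      have hsep := separates_disjointSum hd
      rw [hE₁] at hr₁ hsep
      rw [hE₂] at hr₂
      have hc : component (N₁.disjointSum N₂ hd) x = insert x (S : Set α) :=
        component_eq_of_separates (hE ▸ subset_univ _) (mem_insert x _) hsep (by rw [hr₁]; exact hN₁.conn)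
      refine ⟨N₁.disjointSum N₂ hd, ?_, by rw [hr₁, hr₂]⟩
      rw [Finset.mem_filter, mem_collect, hfib _ hE,
        isQuasiSeriesParallel_iff_of_mem (e := x) (hE ▸ mem_univ x), hc, hE, hr₁, hr₂]
      exact ⟨⟨rfl, hN₁, hN₂⟩, rfl⟩
    · intro M hM
      rw [Finset.mem_filter, mem_collect] at hM
      have hE := hM.1.1
      have hc := (hfib M hE).1 hM.2
      have hsep : Separates M (insert x (S : Set α)) := hc ▸ separates_component M x
      rw [hsep.rk_eq_add (by simp [hE]), numComponents_eq_add_one (e := x) (by simp [hE]), hc, hE,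
        weight, one_pow]
      ring
  · intro M _
    rw [Finset.mem_powerset]
    intro z hz
    rw [Finset.mem_erase] at hz
    simp [hz.1]

theorem qspCount_succ (a z : R) (n : ℕ) :
    qspCount a z (n + 1) = ∑ j ∈ Finset.range (n + 1), n.choose j •
      (z * spCount a 1 (j + 1) * qspCount a z (n - j)) := by
  rw [qspCount, qspSum_univ_eq a z 0]
  have hcard : (Finset.univ \ {0} : Finset (Fin (n + 1))).card = n := by
    rw [Finset.card_sdiff_of_subset (Finset.subset_univ _), Finset.card_singleton]
    simp
  rw [← congrArg (fun m => ∑ j ∈ Finset.range (m + 1), m.choose j •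
      (z * spCount a 1 (j + 1) * qspCount a z (n - j))) hcard,
    ← Finset.sum_powerset_apply_card (fun j =>
      z * spCount a 1 (j + 1) * qspCount a z (n - j))]
  refine Finset.sum_congr rfl fun S hS => ?_
  rw [Finset.mem_powerset] at hS
  have h0 : (0 : Fin (n + 1)) ∉ S := fun h => by simpa using hS h
  have hc0 : (insert 0 S).card = S.card + 1 := Finset.card_insert_of_notMem h0
  have hcc : (Finset.univ \ insert 0 S).card = n - S.card := by
    rw [Finset.card_sdiff_of_subset (Finset.subset_univ _), hc0, Finset.card_univ, Fintype.card_fin]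
    omega
  rw [spSum_eq_spCount, qspSum_eq_qspCount, hc0, hcc]

theorem qspCount_zero (a z : R) : qspCount a z 0 = 1 := by
  have hcol : collect (fun M : Matroid (Fin 0) =>
      M.E = ((Finset.univ : Finset (Fin 0)) : Set (Fin 0)) ∧ IsQuasiSeriesParallel M) =
        {emptyOn (Fin 0)} := by
    ext M
    rw [mem_collect, Finset.mem_singleton]
    constructor
    · rintro ⟨hE, -⟩
      exact ground_eq_empty_iff.1 (by rw [hE]; simp)
    · rintro rfl
      refine ⟨by simp, fun K hK => ?_⟩
      obtain ⟨e, -, -⟩ := hK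
      exact e.elim0
  have hcomp : {L | IsComponent (emptyOn (Fin 0)) L} = ∅ := by
    ext L
    simp only [mem_ofPred_eq, mem_empty_iff_false, iff_false]
    rintro ⟨e, -, -⟩
    exact e.elim0
  rw [qspCount, qspSum, hcol, Finset.sum_singleton, numComponents, hcomp, ncard_empty, rk,
    eRank_emptyOn]
  simp

end QuasiSeriesParallel

section Labelings

theorem card_labelings_mul [Finite α] (G : Type w) [Group G] [Finite G] (M : Matroid α) :
    Nat.card (Quotient (labelingSetoid G M)) * Nat.card G ^ numComponents M =
      Nat.card G ^ M.E.ncard := by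
  have hrep : ∀ L : {L | IsComponent M L}, ∃ e : M.E, (e : α) ∈ L.1 := by
    rintro ⟨_, e, he, rfl⟩
    exact ⟨⟨e, he⟩, mem_component_self he⟩
  choose rep hrep using hrep
  have hcomp : ∀ (L : {L | IsComponent M L}) (e : α), e ∈ L.1 → L.1 = component M e := by
    rintro ⟨_, f, hf, rfl⟩ e he
    exact (component_eq_of_mem he).symm
  let Φ : (M.E → G) → Quotient (labelingSetoid G M) × ({L | IsComponent M L} → G) :=
    fun φ => (Quotient.mk _ φ, fun L => φ (rep L))
  have hΦ : Function.Bijective Φ := by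
    constructor
    · intro φ ψ h
      obtain ⟨h1, h2⟩ := Prod.mk.inj h
      have hr : (labelingSetoid G M).r φ ψ := Quotient.exact h1
      funext e
      let L : {L | IsComponent M L} := ⟨component M e, e, e.2, rfl⟩
      obtain ⟨g, hg⟩ := hr L.1 L.2
      have h3 := congrFun h2 L
      have hg1 : g = 1 := by
        have := hg (rep L) (hrep L)
        rw [h3] at this
        exact (mul_eq_right.1 this.symm)
      rw [hg e (mem_component_self e.2), hg1, one_mul]
    · rintro ⟨c, t⟩
      obtain ⟨ψ, rfl⟩ := Quotient.exists_rep c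
      let K : M.E → {L | IsComponent M L} := fun e => ⟨component M e, e, e.2, rfl⟩
      have hK : ∀ (L : {L | IsComponent M L}) (e : M.E), (e : α) ∈ L.1 → K e = L := fun L e he =>
        Subtype.ext (hcomp L e he).symm
      refine ⟨fun e => t (K e) * (ψ (rep (K e)))⁻¹ * ψ e, Prod.ext (Quotient.sound ?_) ?_⟩
      · intro L hL
        refine ⟨t ⟨L, hL⟩ * (ψ (rep ⟨L, hL⟩))⁻¹, fun e he => ?_⟩
        have := hK ⟨L, hL⟩ e he
        simp only [this]
      · funext L
        have := hK L (rep L) (hrep L)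
        simp only [Φ, this, inv_mul_cancel_right]
  have := Nat.card_congr (Equiv.ofBijective Φ hΦ)
  rw [Nat.card_prod, Nat.card_fun, Nat.card_fun] at this
  simp only [Nat.card_coe_set_eq] at this
  rw [numComponents, this]

end Labelings

end MatroidCounts

open PowerSeries

section PowerSeriesLemmas

variable {K : Type w} [Field K]

/-- The exponential generating function of `u`. -/
noncomputable def expGen (u : ℕ → K) : PowerSeries K :=
  PowerSeries.mk fun n => u n / (n.factorial : K)

@[simp] theorem constantCoeff_expGen (u : ℕ → K) : constantCoeff (expGen u) = u 0 := by
  rw [← coeff_zero_eq_constantCoeff_apply, expGen, coeff_mk]; simp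

theorem expGen_sub (u v : ℕ → K) : expGen u - expGen v = expGen (u - v) := by
  ext n; simp [expGen, sub_div]

theorem C_mul_expGen (c : K) (u : ℕ → K) : C c * expGen u = expGen (c • u) := by
  ext n; simp [expGen, mul_div_assoc]

theorem derivative_rescale (c : K) (f : PowerSeries K) :
    d⁄dX K (rescale c f) = C c * rescale c (d⁄dX K f) := by
  ext n
  rw [coeff_derivative, coeff_rescale, coeff_C_mul, coeff_rescale, coeff_derivative]
  ring

@[simp] theorem constantCoeff_rescale (c : K) (f : PowerSeries K) :
    constantCoeff (rescale c f) = constantCoeff f := by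
  rw [← coeff_zero_eq_constantCoeff_apply, coeff_rescale]; simp

theorem constantCoeff_subst_of_eq_zero {g : PowerSeries K} (hg : constantCoeff g = 0)
    (f : PowerSeries K) : constantCoeff (f.subst g) = constantCoeff f := by
  have hs : HasSubst g := HasSubst.of_constantCoeff_zero' hg
  have h := constantCoeff_subst_eq_zero (a := g) hg (f - C (constantCoeff f)) (by simp)
  rw [subst_sub hs, subst_C] at h
  have h' : constantCoeff (f.subst g - C (constantCoeff f)) = 0 := h
  rw [map_sub, constantCoeff_C] at h'
  exact sub_eq_zero.1 h'

theorem subst_one {g : PowerSeries K} (hg : HasSubst g) :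
    (1 : PowerSeries K).subst g = 1 := by
  rw [← coe_substAlgHom hg, map_one]

theorem subst_C_mul {g : PowerSeries K} (hg : HasSubst g) (c : K) (f : PowerSeries K) :
    (C c * f).subst g = C c * f.subst g := by
  rw [subst_mul hg, subst_C]; rfl

section Exp

variable [Algebra ℚ K]

theorem derivative_exp_subst {F : PowerSeries K} (hF : constantCoeff F = 0) :
    d⁄dX K ((exp K).subst F) = d⁄dX K F * (exp K).subst F := by
  rw [derivative_subst (HasSubst.of_constantCoeff_zero' hF), derivative_exp, mul_comm]

theorem constantCoeff_exp_subst {F : PowerSeries K} (hF : constantCoeff F = 0) :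
    constantCoeff ((exp K).subst F) = 1 := by
  rw [constantCoeff_subst_of_eq_zero hF, constantCoeff_exp]

theorem one_add_X_mul_derivative_log : (1 + X) * d⁄dX K (log K) = 1 := by
  rw [deriv_log]
  ext n
  cases n with
  | zero => simp [add_mul]
  | succ n => simp [add_mul, coeff_succ_X_mul, pow_succ, coeff_one]

end Exp

variable [CharZero K]

theorem derivative_expGen (u : ℕ → K) : d⁄dX K (expGen u) = expGen fun n => u (n + 1) := by
  ext n
  rw [coeff_derivative, expGen, expGen, coeff_mk, coeff_mk, Nat.factorial_succ]
  have h1 : (n.factorial : K) ≠ 0 := Nat.cast_ne_zero.2 n.factorial_ne_zero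
  have h2 : (n : K) + 1 ≠ 0 := Nat.cast_add_one_ne_zero n
  push_cast
  field_simp

theorem expGen_mul (u v : ℕ → K) : expGen u * expGen v =
    expGen fun n => ∑ j ∈ Finset.range (n + 1), n.choose j • (u j * v (n - j)) := by
  ext n
  rw [coeff_mul, expGen, expGen, expGen, coeff_mk,
    Finset.Nat.sum_antidiagonal_eq_sum_range_succ
      (fun i j => coeff i (mk fun n => u n / (n.factorial : K)) *
        coeff j (mk fun n => v n / (n.factorial : K))), Finset.sum_div]
  refine Finset.sum_congr rfl fun j hj => ?_
  have hj : j ≤ n := Nat.lt_succ_iff.1 (Finset.mem_range.1 hj)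
  have h1 : (n.factorial : K) ≠ 0 := Nat.cast_ne_zero.2 n.factorial_ne_zero
  have h2 : (j.factorial : K) ≠ 0 := Nat.cast_ne_zero.2 j.factorial_ne_zero
  have h3 : ((n - j).factorial : K) ≠ 0 := Nat.cast_ne_zero.2 (n - j).factorial_ne_zero
  rw [coeff_mk, coeff_mk, nsmul_eq_mul, Nat.cast_choose K hj]
  field_simp

theorem eq_zero_of_derivative_eq_mul {f w : PowerSeries K} (hf : d⁄dX K f = w * f)
    (h0 : constantCoeff f = 0) : f = 0 := by
  ext n
  rw [map_zero]
  induction n using Nat.strong_induction_on with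
  | _ n ih =>
    cases n with
    | zero => rw [coeff_zero_eq_constantCoeff_apply, h0]
    | succ n =>
      have h := congrArg (coeff n) hf
      rw [coeff_derivative, coeff_mul, Finset.sum_eq_zero] at h
      · exact (mul_eq_zero.1 h).resolve_right (Nat.cast_add_one_ne_zero n)
      · intro p hp
        rw [ih p.2 (by have := Finset.HasAntidiagonal.mem_antidiagonal.1 hp; omega), mul_zero]

theorem eq_of_derivative_eq_mul {f g w : PowerSeries K} (hf : d⁄dX K f = w * f)
    (hg : d⁄dX K g = w * g) (h0 : constantCoeff f = constantCoeff g) : f = g := by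
  refine sub_eq_zero.1 (eq_zero_of_derivative_eq_mul (w := w) ?_ ?_)
  · rw [map_sub, hf, hg, mul_sub]
  · rw [map_sub, h0, sub_self]

variable [Algebra ℚ K]

theorem one_add_X_mul_derivative_binomialSeries (r : ℚ) :
    (1 + X) * d⁄dX K (binomialSeries K r) = C (algebraMap ℚ K r) * binomialSeries K r := by
  have key : ∀ n : ℕ, Ring.choose r (n + 1) * ((n : ℚ) + 1) = Ring.choose r n * (r - n) := by
    intro n
    have h := Ring.choose_eq_smul (a := r) (n := n)
    have h' := Ring.choose_eq_smul (a := r) (n := n + 1)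
    rw [descPochhammer_succ_right] at h'
    rw [Polynomial.smeval_mul, Polynomial.smeval_sub, Polynomial.smeval_X,
      Polynomial.smeval_natCast] at h'
    rw [h, h', Nat.factorial_succ]
    have h1 : (n.factorial : ℚ) ≠ 0 := Nat.cast_ne_zero.2 n.factorial_ne_zero
    have h2 : (n : ℚ) + 1 ≠ 0 := Nat.cast_add_one_ne_zero n
    simp only [smul_eq_mul, pow_one, pow_zero, nsmul_one]
    push_cast
    field_simp
  have hc : ∀ n, coeff n (binomialSeries K r) = algebraMap ℚ K (Ring.choose r n) := by
    intro n
    rw [binomialSeries_coeff, Algebra.smul_def, mul_one]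
  ext n
  rw [coeff_C_mul, hc, add_mul, one_mul, map_add, coeff_derivative, hc]
  have hk : algebraMap ℚ K (Ring.choose r (n + 1)) * (n + 1) =
      algebraMap ℚ K (Ring.choose r n) * (algebraMap ℚ K r - n) := by
    simpa using congrArg (algebraMap ℚ K) (key n)
  rw [hk]
  cases n with
  | zero => simp
  | succ n =>
    rw [coeff_succ_X_mul, coeff_derivative, hc]
    push_cast
    ring

/-- The binomial power of an exponential: `exp(F)^r = exp(r F)`, as the statement that
`exp(F)^r` is the solution of the differential equation of `exp(r F)`. -/
theorem eq_binomialSeries_subst {r : ℚ} {F f h : PowerSeries K} (hf : d⁄dX K f = d⁄dX K F * f)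
    (hf0 : constantCoeff f = 1) (hh : d⁄dX K h = C (algebraMap ℚ K r) * d⁄dX K F * h)
    (hh0 : constantCoeff h = 1) : h = (binomialSeries K r).subst (f - 1) := by
  have h0 : constantCoeff (f - 1) = 0 := by rw [map_sub, hf0, map_one, sub_self]
  have hs : HasSubst (f - 1) := HasSubst.of_constantCoeff_zero' h0
  refine eq_of_derivative_eq_mul hh ?_ ?_
  · have h1 := congrArg (fun p => p.subst (f - 1)) (one_add_X_mul_derivative_binomialSeries (K := K) r)
    simp only [subst_C_mul hs] at h1
    simp only [subst_mul hs, subst_add hs, subst_one hs, subst_X hs] at h1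
    rw [derivative_subst hs, map_sub, derivative_one, sub_zero, hf]
    linear_combination (d⁄dX K F) * h1
  · rw [hh0, constantCoeff_subst_of_eq_zero h0, binomialSeries_constantCoeff]

end PowerSeriesLemmas

section GeneratingFunctions

theorem sum_range_collect_eRank {n : ℕ} (p : Matroid (Fin n) → Prop)
    (c : Matroid (Fin n) → Coeffs) (z : Coeffs) :
    ∑ k ∈ Finset.range (n + 1),
      (∑ M ∈ collect (fun M => M.E = univ ∧ p M ∧ M.eRank = (k : ℕ∞)), c M) * z ^ k =
    ∑ M ∈ collect (fun M => M.E = univ ∧ p M), c M * z ^ rk M := by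
  classical
  rw [← Finset.sum_fiberwise_of_maps_to (t := Finset.range (n + 1)) (g := rk)]
  · refine Finset.sum_congr rfl fun k _ => ?_
    rw [Finset.sum_mul]
    refine Finset.sum_congr ?_ fun M hM => ?_
    · ext M
      rw [Finset.mem_filter, mem_collect, mem_collect, eRank_eq_iff, and_assoc]
    · rw [(Finset.mem_filter.1 hM).2]
  · intro M _
    have h := (rk_le_ncard M).trans (ncard_le_card M.E)
    rw [Finset.mem_range]
    simpa [Nat.lt_succ_iff] using h

theorem card_subtype_eq {α : Type u} [Finite α] (p : Matroid α → Prop) :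
    Nat.card {M // p M} = (collect p).card := by
  rw [collect, ← ncard_eq_toFinset_card, ← Nat.card_coe_set_eq]
  rfl

theorem card_labeledQSPMatroid (G : Type v) [Group G] [Finite G] (n k : ℕ) :
    Nat.card (LabeledQSPMatroid G n k) =
      ∑ M ∈ collect (fun M : Matroid (Fin n) =>
        M.E = univ ∧ IsQuasiSeriesParallel M ∧ M.eRank = (k : ℕ∞)),
        Nat.card (Quotient (labelingSetoid G M)) := by
  classical
  have : Finite (QSPMatroid n k) := inferInstanceAs (Finite {M : Matroid (Fin n) //
    M.E = univ ∧ IsQuasiSeriesParallel M ∧ M.eRank = (k : ℕ∞)})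
  have := Fintype.ofFinite (QSPMatroid n k)
  rw [LabeledQSPMatroid, Nat.card_sigma]
  exact (Finset.sum_subtype _ (fun M => mem_collect)
    (fun M => Nat.card (Quotient (labelingSetoid G M)))).symm

theorem genC_eq : genC = expGen (spCount y 1) := by
  ext n
  rw [genC, egf, expGen, coeff_mk, coeff_mk, spCount, spSum, Finset.coe_univ]
  simp only [weight, one_pow, mul_one]
  have h := sum_range_collect_eRank (n := n) IsSeriesParallel (fun _ => 1) y
  simp only [one_mul] at h
  rw [← h, Finset.sum_div]
  refine Finset.sum_congr rfl fun k _ => ?_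
  rw [SPMatroid, card_subtype_eq, Finset.sum_const, nsmul_one]
  ring

theorem genA_eq : genA = expGen (qspCount y 1) := by
  ext n
  rw [genA, egf, expGen, coeff_mk, coeff_mk, qspCount, qspSum, Finset.coe_univ]
  simp only [one_pow, mul_one]
  have h := sum_range_collect_eRank (n := n) IsQuasiSeriesParallel (fun _ => 1) y
  simp only [one_mul] at h
  rw [← h, Finset.sum_div]
  refine Finset.sum_congr rfl fun k _ => ?_
  rw [QSPMatroid, card_subtype_eq, Finset.sum_const, nsmul_one]
  ring

theorem genAG_eq (G : Type v) [Group G] [Finite G] : genAG G =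
    scale (Nat.card G : Coeffs) (expGen (qspCount y (Nat.card G : Coeffs)⁻¹)) := by
  have hq : (Nat.card G : Coeffs) ≠ 0 := Nat.cast_ne_zero.2 Nat.card_pos.ne'
  ext n
  rw [genAG, egf, scale, coeff_rescale, expGen, coeff_mk, coeff_mk, qspCount, qspSum,
    Finset.coe_univ]
  have h := sum_range_collect_eRank (n := n) IsQuasiSeriesParallel
    (fun M => (Nat.card (Quotient (labelingSetoid G M)) : Coeffs)) y
  have hc : ∀ M ∈ collect (fun M : Matroid (Fin n) => M.E = univ ∧ IsQuasiSeriesParallel M),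
      (Nat.card (Quotient (labelingSetoid G M)) : Coeffs) * y ^ rk M =
        (Nat.card G : Coeffs) ^ n * (y ^ rk M * (Nat.card G : Coeffs)⁻¹ ^ numComponents M) := by
    intro M hM
    rw [mem_collect] at hM
    have h1 := congrArg (Nat.cast : ℕ → Coeffs) (card_labelings_mul G M)
    rw [show M.E.ncard = n by rw [hM.1, ncard_univ, Nat.card_fin]] at h1
    push_cast at h1
    rw [← h1, inv_pow]
    field_simp
  rw [Finset.sum_congr rfl hc, ← Finset.mul_sum] at h
  rw [← mul_div_assoc, ← h, Finset.sum_div]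
  refine Finset.sum_congr rfl fun k _ => ?_
  rw [card_labeledQSPMatroid, Nat.cast_sum]
  ring

theorem y_ne_zero : y ≠ 0 := RatFunc.X_ne_zero

theorem C_y_mul_C_y_inv : C y * C y⁻¹ = (1 : PowerSeries Coeffs) := by
  rw [← map_mul, mul_inv_cancel₀ y_ne_zero, map_one]

theorem C_mul_derivative_expGen_parCount (a b : Coeffs) :
    C a * d⁄dX Coeffs (expGen (parCount a b)) =
      (d⁄dX Coeffs (expGen (rootedCount a b)) - d⁄dX Coeffs (expGen (parCount a b))) *
        expGen (rootedCount a b) := by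
  rw [derivative_expGen, derivative_expGen, C_mul_expGen, expGen_sub, expGen_mul]
  congr 1
  ext n
  exact mul_parCount_succ a b n

theorem expGen_rootedCount_eq :
    expGen (rootedCount y 1) =
      C y * X + expGen (parCount y 1) + expGen (parCount 1 y) := by
  ext n
  rw [map_add, map_add, coeff_C_mul, coeff_X, expGen, expGen, expGen, coeff_mk, coeff_mk, coeff_mk]
  rcases Nat.lt_or_ge n 2 with hn | hn
  · rw [parCount_of_le_one y 1 (by omega), parCount_of_le_one 1 y (by omega)]
    interval_cases n
    · simp [rootedCount]
    · simp [rootedCount_one]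
  · rw [rootedCount_eq_parCount_add y 1 hn, if_neg (by omega)]
    ring

theorem derivative_genC :
    d⁄dX Coeffs genC = C (y + 1) + expGen (rootedCount y 1) := by
  rw [genC_eq, derivative_expGen]
  ext n
  rw [map_add, coeff_C, expGen, expGen, coeff_mk, coeff_mk, rootedCount]
  rcases Nat.eq_zero_or_pos n with rfl | hn
  · simp [spCount_one]
  · rw [if_neg hn.ne', if_neg hn.ne', zero_add]

theorem constantCoeff_genC : constantCoeff genC = 0 := by
  rw [genC_eq, constantCoeff_expGen, spCount, spSum]
  refine Finset.sum_eq_zero fun M hM => ?_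
  rw [mem_collect] at hM
  obtain ⟨e, -⟩ := hM.2.nonempty
  exact e.elim0

theorem rootedCount_comm (a b : Coeffs) : rootedCount a b = rootedCount b a := by
  ext n
  rw [rootedCount, rootedCount, spCount, spCount]
  split_ifs
  · rfl
  · refine Finset.sum_bij' (fun M _ => M✶) (fun M _ => M✶) ?_ ?_ (fun M _ => dual_dual M)
      (fun M _ => dual_dual M) (fun M _ => (weight_dual b a M).symm)
    all_goals
      intro M hM
      rw [mem_collect] at hM ⊢
      exact ⟨hM.1, hM.2.dual⟩

theorem derivative_innerSeries : ∃ A B : PowerSeries Coeffs, (1 + C y * X) * A = 1 ∧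
    (1 + X) * B = 1 ∧ d⁄dX Coeffs innerSeries = A + B - 1 := by
  refine ⟨rescale y (d⁄dX Coeffs (log Coeffs)), d⁄dX Coeffs (log Coeffs), ?_,
    one_add_X_mul_derivative_log, ?_⟩
  · have h := congrArg (rescale y) (one_add_X_mul_derivative_log (K := Coeffs))
    rw [map_mul, map_add, map_one, rescale_X] at h
    exact h
  · rw [innerSeries, map_sub, map_add, derivative_X, Derivation.leibniz, derivative_C, smul_zero,
      add_zero, smul_eq_mul, scale, derivative_rescale, ← mul_assoc, mul_comm (C y⁻¹),
      C_y_mul_C_y_inv, one_mul]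

theorem innerInverse_eq : innerInverse = C y⁻¹ * expGen (rootedCount y 1) := by
  set D := expGen (rootedCount y 1) with hD
  set E := C y⁻¹ * D with hE
  have hDE : D = C y * E := by rw [hE, ← mul_assoc, C_y_mul_C_y_inv, one_mul]
  have hE0 : constantCoeff E = 0 := by
    rw [hE, map_mul, hD, constantCoeff_expGen, rootedCount, if_pos rfl, mul_zero]
  have hs : HasSubst E := HasSubst.of_constantCoeff_zero' hE0
  have hP := C_mul_derivative_expGen_parCount y 1
  have hS := C_mul_derivative_expGen_parCount 1 y
  rw [rootedCount_comm 1 y] at hS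
  rw [← hD] at hP hS
  set P := d⁄dX Coeffs (expGen (parCount y 1))
  set S := d⁄dX Coeffs (expGen (parCount 1 y))
  have hd : d⁄dX Coeffs D = C y + P + S := by
    rw [hD, expGen_rootedCount_eq, map_add, map_add, Derivation.leibniz, derivative_C,
      derivative_X, smul_zero, add_zero, smul_eq_mul, mul_one]
  have hd' : d⁄dX Coeffs D = C y * d⁄dX Coeffs E := by
    rw [hDE, Derivation.leibniz, derivative_C, smul_zero, add_zero, smul_eq_mul]
  have hy : (C y : PowerSeries Coeffs) ≠ 0 := left_ne_zero_of_mul_eq_one C_y_mul_C_y_inv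
  have hX : innerSeries.subst E = X := by
    refine derivative.ext ?_ ?_
    · obtain ⟨A, B, hA, hB, hAB⟩ := derivative_innerSeries
      replace hA := congrArg (fun p => p.subst E) hA
      replace hB := congrArg (fun p => p.subst E) hB
      rw [subst_mul hs, subst_add hs, subst_C_mul hs, subst_one hs, subst_X hs] at hA
      rw [subst_mul hs, subst_add hs, subst_one hs, subst_X hs] at hB
      rw [derivative_subst hs, derivative_X, hAB, subst_sub hs, subst_add hs, subst_one hs]
      set a := A.subst E
      set b := B.subst E
      rw [← hDE] at hA
      rw [C.map_one, one_mul] at hS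
      have hP' : P * (1 + E) = d⁄dX Coeffs D * E := by
        refine mul_left_cancel₀ hy ?_
        rw [hDE] at hP ⊢
        linear_combination hP
      have hP'' : P = (1 - b) * d⁄dX Coeffs D := by
        linear_combination b * hP' - P * hB + d⁄dX Coeffs D * hB
      have hS'' : S = (1 - a) * d⁄dX Coeffs D := by
        linear_combination a * hS - S * hA + d⁄dX Coeffs D * hA
      refine mul_left_cancel₀ hy ?_
      linear_combination hP'' + hS'' + hd + (1 - a - b) * hd'
    · rw [constantCoeff_subst_of_eq_zero hE0, constantCoeff_innerSeries, constantCoeff_X]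
  have hi : innerInverse.subst innerSeries = X :=
    subst_substInvOfIsUnit_left innerSeries constantCoeff_innerSeries
      isUnit_coeff_one_innerSeries
  have hsi : HasSubst innerSeries := HasSubst.of_constantCoeff_zero' constantCoeff_innerSeries
  have h := subst_comp_subst_apply hsi hs innerInverse
  rw [hX, hi, subst_X hs, X_subst] at h
  exact h.symm

theorem constantCoeff_antideriv (f : PowerSeries Coeffs) : constantCoeff (antideriv f) = 0 := by
  rw [← coeff_zero_eq_constantCoeff_apply, antideriv, coeff_mk, if_pos rfl]

theorem derivative_antideriv (f : PowerSeries Coeffs) : d⁄dX Coeffs (antideriv f) = f := by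
  ext n
  have h : (n : Coeffs) + 1 ≠ 0 := Nat.cast_add_one_ne_zero n
  rw [coeff_derivative, antideriv, coeff_mk, if_neg (by simp), Nat.add_sub_cancel]
  push_cast
  field_simp

theorem genC_eq_explicitC : genC = explicitC := by
  refine derivative.ext ?_ ?_
  · rw [derivative_genC, explicitC, map_add (d⁄dX Coeffs), Derivation.leibniz, Derivation.leibniz, derivative_C,
      derivative_C, derivative_X, smul_zero, smul_zero, zero_add, add_zero, derivative_antideriv,
      innerInverse_eq, smul_eq_mul, smul_eq_mul, mul_one, ← mul_assoc, C_y_mul_C_y_inv, one_mul]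
  · rw [constantCoeff_genC, explicitC, map_add, map_mul, map_mul, constantCoeff_antideriv,
      constantCoeff_X, zero_mul, mul_zero, add_zero]

theorem constantCoeff_explicitC : constantCoeff explicitC = 0 := by
  rw [← genC_eq_explicitC, constantCoeff_genC]

theorem derivative_expGen_qspCount (z : Coeffs) :
    d⁄dX Coeffs (expGen (qspCount y z)) =
      C z * d⁄dX Coeffs explicitC * expGen (qspCount y z) := by
  rw [← genC_eq_explicitC, genC_eq, derivative_expGen, derivative_expGen, C_mul_expGen, expGen_mul]
  congr 1
  ext n
  exact qspCount_succ y z n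

theorem constantCoeff_expGen_qspCount (z : Coeffs) :
    constantCoeff (expGen (qspCount y z)) = 1 := by
  rw [constantCoeff_expGen, qspCount_zero]

theorem derivative_genA : d⁄dX Coeffs genA = d⁄dX Coeffs explicitC * genA := by
  rw [genA_eq, derivative_expGen_qspCount, C.map_one, one_mul]

theorem genA_eq_expOf : genA = expOf explicitC := by
  refine eq_of_derivative_eq_mul derivative_genA (derivative_exp_subst constantCoeff_explicitC) ?_
  rw [expOf, constantCoeff_exp_subst constantCoeff_explicitC, genA_eq,
    constantCoeff_expGen_qspCount]

theorem rescale_C_apply (c r : Coeffs) : rescale c (C r) = C r := by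
  ext n
  rw [coeff_rescale, coeff_C]
  split_ifs with h
  · rw [h, pow_zero, one_mul]
  · rw [mul_zero]

theorem smul_one_eq_algebraMap (c : ℚ) : c • (1 : RatFunc ℚ) = algebraMap ℚ (RatFunc ℚ) c := by
  have h := RatFunc.mk_smul c (1 : Polynomial ℚ) 1
  rw [RatFunc.mk_one, RatFunc.mk_one, map_one, Polynomial.smul_eq_C_mul, mul_one] at h
  rw [← h]
  exact RingHom.congr_fun (Subsingleton.elim
    ((algebraMap (Polynomial ℚ) (RatFunc ℚ)).comp Polynomial.C) (algebraMap ℚ (RatFunc ℚ))) c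

theorem ratPow_eq (f : PowerSeries Coeffs) (r : ℚ) :
    ratPow f r =
      (@PowerSeries.binomialSeries ℚ _ _ Coeffs _ Algebra.toSMul r).subst (f - 1) := by
  have h : PowerSeries.binomialSeries Coeffs r =
      @PowerSeries.binomialSeries ℚ _ _ Coeffs _ Algebra.toSMul r := by
    ext n
    rw [PowerSeries.binomialSeries, PowerSeries.binomialSeries, coeff_mk, coeff_mk]
    exact (smul_one_eq_algebraMap _).trans (by rw [Algebra.smul_def, mul_one])
  rw [ratPow, h]

theorem genAG_eq_ratPow (G : Type v) [Group G] [Finite G] {f : PowerSeries Coeffs}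
    (hf : d⁄dX Coeffs f = d⁄dX Coeffs (scale (Nat.card G : Coeffs) explicitC) * f)
    (hf0 : constantCoeff f = 1) : genAG G = ratPow f (1 / (Nat.card G : ℚ)) := by
  rw [ratPow_eq]
  refine eq_binomialSeries_subst (r := 1 / (Nat.card G : ℚ)) hf hf0 ?_ ?_
  · rw [genAG_eq, scale, scale, derivative_rescale, derivative_rescale,
      derivative_expGen_qspCount, map_mul, map_mul, rescale_C_apply,
      show algebraMap ℚ Coeffs (1 / (Nat.card G : ℚ)) = (Nat.card G : Coeffs)⁻¹ by
        rw [one_div, map_inv₀, map_natCast]]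
    ring
  · rw [genAG_eq, scale, constantCoeff_rescale, constantCoeff_expGen_qspCount]

end GeneratingFunctions

end GroupLabeledMatroid

open GroupLabeledMatroid in
/-- With `q = |G|`: the generating function `C` of series-parallel matroids is the explicit one,
the generating function `A` of quasi series-parallel matroids is `exp(C(x,y))`, and
`A_G(x,y) = exp(C(qx,y))^{1/q} = A(qx,y)^{1/q}`. -/
theorem proposition3p2 (G : Type*) [Group G] [Finite G] :
    genC = explicitC ∧
    genA = expOf explicitC ∧
    genAG G = ratPow (expOf (scale (Nat.card G : Coeffs) explicitC)) (1 / (Nat.card G : ℚ)) ∧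
    genAG G = ratPow (scale (Nat.card G : Coeffs) genA) (1 / (Nat.card G : ℚ)) := by
  refine ⟨genC_eq_explicitC, genA_eq_expOf, genAG_eq_ratPow G ?_ ?_, genAG_eq_ratPow G ?_ ?_⟩
  · exact derivative_exp_subst (by rw [scale, constantCoeff_rescale, constantCoeff_explicitC])
  · exact constantCoeff_exp_subst (by rw [scale, constantCoeff_rescale, constantCoeff_explicitC])
  · rw [scale, scale, derivative_rescale, derivative_rescale, derivative_genA, map_mul, mul_assoc]
  · rw [scale, constantCoeff_rescale, genA_eq, constantCoeff_expGen_qspCount]
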